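/- Let $\zeta_7=e^{2\pi i/7}$ and regard $\mathbb{Q}(\zeta_7)\subset\mathbb{Q}(i,\zeta_7)$ as subfields of $\mathbb{C}$. Let $\sigma,\tau$ be the automorphisms of $\mathbb{Q}(i,\zeta_7)$ with $\sigma(i)=-i$, $\sigma(\zeta_7)=\zeta_7$ and $\tau(i)=i$, $\tau(\zeta_7)=\zeta_7^2$. For $c,d\in\mathbb{Q}(i,\zeta_7)$ put $$X(c,d)=\begin{pmatrix} c & -\sqrt{11}\,\sigma(d)\\ \sqrt{11}\,d & \sigma(c)\end{pmatrix},\qquad \alpha_\tau(X)=\operatorname{diag}\bigl(X,\tau(X),\tau^2(X)\bigr)\in M_6(\mathbb{C}),$$ where $\tau$ acts entrywise and fixes $\sqrt{11}$, and let $\mathcal{C}=\{\alpha_\tau(X(c,d)) : c,d\in\mathbb{Z}[i,\zeta_7]\}$. Then: 1. The quaternion algebras $\left(\frac{-11,\,-1}{\mathbb{Q}(\zeta_7)}\right)$ and $\left(\frac{-1,\,-11}{\mathbb{Q}(\zeta_7)}\right)$ are division algebras, and there is an injective $\mathbb{Q}(\zeta_7)$-algebra homomorphism of the latter into $M_2(\mathbb{C})$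 with image $\{X(c,d): c,d\in\mathbb{Q}(i,\zeta_7)\}$. 2. $\mathcal{C}$ has rank $24$: there are $B_1,\dots,B_{24}\in M_6(\mathbb{C})$, linearly independent over $\mathbb{R}$, with $\mathcal{C}=\{\sum_l g_lB_l : g_l\in\mathbb{Z}\}$. 3. $\mathcal{C}$ has the nonvanishing determinant (NVD) property: there is $\kappa>0$ with $\det(Z^\dagger Z)>\kappa$ for all $0\neq Z\in\mathcal{C}$. Moreover $\det Z\in\mathbb{Q}(\sqrt{-7})$ for all $Z\in\mathcal{C}$. 4. $\mathcal{C}$ is conditionally $4$-group decodable with real decoding complexity of order $|S|^{15}$. That is, generators $B_1,\dots,B_{24}$ as in 2 and a partition of $\{1,\dots,24\}$ into nonempty sets $\Gamma_1,\dots,\Gamma_4$ and a set $\Gamma^C$ exist such that $\|B_l^\dagger B_m+B_m^\dagger B_l\|_F=0$ whenever $l\in\Gamma_i$, $m\in\Gamma_j$, $i\ne j$, and $|\Gamma^C|+\max_i|\Gamma_i|=15$. Furthermore, for these generators, there is a constant $K$ such that for every nonempty finite alphabet $S\subset\mathbb{Z}$ there is a search procedure on $S^{24}$, branching only on comparisons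 of values of the metric, which for every $n$, every channel matrix $H\in M_{n\times 6}(\mathbb{C})$ and every received matrix $Y\in M_{n\times 6}(\mathbb{C})$ finds a minimizer $g\in S^{24}$ of $\|Y-H\sum_l g_lB_l\|_F^2$ after computing this metric at no more than $K|S|^{15}$ vectors. -/

import Mathlib

namespace RelayCode

noncomputable section

/-! ### The fields -/

/-- The primitive seventh root of unity `exp(2πi/7)`. -/
def zeta7 : ℂ := Complex.exp (2 * Real.pi * Complex.I / 7)

/-- `K' = ℚ(ζ₇)`, as a subfield of `ℂ`. -/
abbrev FieldK : IntermediateField ℚ ℂ := IntermediateField.adjoin ℚ {zeta7}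

/-- `L' = ℚ(i, ζ₇)`, as a subfield of `ℂ`. -/
abbrev FieldL : IntermediateField ℚ ℂ := IntermediateField.adjoin ℚ {Complex.I, zeta7}

/-- `ℚ(√-7)`, as a subfield of `ℂ`. -/
abbrev FieldQ7 : IntermediateField ℚ ℂ :=
  IntermediateField.adjoin ℚ {(Real.sqrt 7 : ℂ) * Complex.I}

/-- `i` as an element of `L'`. -/
def iL : FieldL := ⟨Complex.I, IntermediateField.subset_adjoin ℚ _ (by simp)⟩

/-- `ζ₇` as an element of `L'`. -/
def zL : FieldL := ⟨zeta7, IntermediateField.subset_adjoin ℚ _ (by simp)⟩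

/-- The ring `ℤ[i, ζ₇]`, inside `L'`. -/
def intRing : Subalgebra ℤ FieldL := Algebra.adjoin ℤ {iL, zL}

theorem zeta7_primitive : IsPrimitiveRoot zeta7 7 := by
  have := Complex.isPrimitiveRoot_exp 7 (by norm_num)
  simpa [zeta7] using this

theorem iL_sq : iL ^ 2 = -1 := by
  apply Subtype.ext
  simp [iL]

theorem zL_pow : zL ^ 7 = 1 := by
  apply Subtype.ext
  simpa [zL] using zeta7_primitive.pow_eq_one

/-- `i³ ζ₇²` is a primitive 28th root of unity. -/
theorem xi_primitive : IsPrimitiveRoot (Complex.I ^ 3 * zeta7 ^ 2) 28 := by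
  have h := Complex.isPrimitiveRoot_exp 28 (by norm_num)
  have hI : Complex.I = Complex.exp (2 * Real.pi * Complex.I / 28) ^ 7 := by
    rw [← Complex.exp_nat_mul]
    refine Complex.exp_pi_div_two_mul_I.symm.trans ?_
    congr 1
    push_cast
    ring
  have hz : zeta7 = Complex.exp (2 * Real.pi * Complex.I / 28) ^ 4 := by
    rw [← Complex.exp_nat_mul, zeta7]
    congr 1
    push_cast
    ring
  have h1 : Complex.I ^ 3 * zeta7 ^ 2
      = Complex.exp (2 * Real.pi * Complex.I / 28) ^ 29 := by
    rw [hz]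
    nth_rewrite 1 [hI]
    ring
  rw [h1]
  exact IsPrimitiveRoot.pow_of_coprime (by simpa using h) 29 (by norm_num)

theorem adjoin_xi :
    IntermediateField.adjoin ℚ {Complex.I ^ 3 * zeta7 ^ 2} = FieldL := by
  set ξ := Complex.I ^ 3 * zeta7 ^ 2 with hξ
  have h7 : zeta7 ^ 7 = 1 := zeta7_primitive.pow_eq_one
  have hI : Complex.I ^ 2 = -1 := Complex.I_sq
  apply le_antisymm
  · rw [IntermediateField.adjoin_le_iff]
    rintro x rfl
    exact mul_mem (pow_mem iL.2 3) (pow_mem zL.2 2)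
  · rw [IntermediateField.adjoin_le_iff]
    have hm : ξ ∈ IntermediateField.adjoin ℚ {ξ} :=
      IntermediateField.subset_adjoin ℚ _ rfl
    rintro x (rfl | rfl)
    · have : Complex.I = ξ ^ 7 := by
        rw [hξ, show (Complex.I ^ 3 * zeta7 ^ 2) ^ 7
          = Complex.I * (Complex.I ^ 2) ^ 10 * (zeta7 ^ 7) ^ 2 by ring, h7, hI]
        ring
      exact this ▸ pow_mem hm 7
    · have : zeta7 = ξ ^ 4 := by
        rw [hξ, show (Complex.I ^ 3 * zeta7 ^ 2) ^ 4
          = zeta7 * (Complex.I ^ 2) ^ 6 * zeta7 ^ 7 by ring, h7, hI]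
        ring
      exact this ▸ pow_mem hm 4

theorem fieldL_cyclotomic : IsCyclotomicExtension {28} ℚ FieldL := by
  rw [← adjoin_xi]
  have hint : IsIntegral ℚ (Complex.I ^ 3 * zeta7 ^ 2) :=
    (xi_primitive.isIntegral (by norm_num)).tower_top
  change IsCyclotomicExtension {28} ℚ
    (IntermediateField.adjoin ℚ {Complex.I ^ 3 * zeta7 ^ 2}).toSubalgebra
  rw [IntermediateField.adjoin_simple_toSubalgebra_of_isAlgebraic hint.isAlgebraic]
  exact xi_primitive.adjoin_isCyclotomicExtension ℚ

/-- For every `a` prime to 28 there is an automorphism of `L'` raising `i` and `ζ₇` to the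
power `a`. -/
theorem exists_aut (a : ℕ) (ha : a.Coprime 28) :
    ∃ f : FieldL ≃ₐ[ℚ] FieldL, f iL = iL ^ a ∧ f zL = zL ^ a := by
  have := fieldL_cyclotomic
  have hz := IsCyclotomicExtension.zeta_spec 28 ℚ FieldL
  have hirr : Irreducible (Polynomial.cyclotomic 28 ℚ) :=
    Polynomial.cyclotomic.irreducible_rat (by norm_num)
  have hf := IsCyclotomicExtension.fromZetaAut_spec (hz.pow_of_coprime a ha) hirr
  refine ⟨IsCyclotomicExtension.fromZetaAut (hz.pow_of_coprime a ha) hirr, ?_, ?_⟩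
  · have h1 : iL ^ 28 = 1 := by
      rw [show iL ^ 28 = (iL ^ 2) ^ 14 by ring, iL_sq]; norm_num
    obtain ⟨k, -, hk⟩ := hz.eq_pow_of_pow_eq_one h1
    rw [← hk, map_pow, hf, ← pow_mul, ← pow_mul, mul_comm]
  · have h1 : zL ^ 28 = 1 := by
      rw [show zL ^ 28 = (zL ^ 7) ^ 4 by ring, zL_pow]; norm_num
    obtain ⟨k, -, hk⟩ := hz.eq_pow_of_pow_eq_one h1
    rw [← hk, map_pow, hf, ← pow_mul, ← pow_mul, mul_comm]

theorem exists_sigma : ∃ f : FieldL ≃ₐ[ℚ] FieldL, f iL = -iL ∧ f zL = zL := by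
  obtain ⟨f, h1, h2⟩ := exists_aut 15 (by norm_num)
  refine ⟨f, ?_, ?_⟩
  · rw [h1, show iL ^ 15 = iL * (iL ^ 2) ^ 7 by ring, iL_sq]; ring
  · rw [h2, show zL ^ 15 = zL * (zL ^ 7) ^ 2 by ring, zL_pow]; ring

theorem exists_tau : ∃ f : FieldL ≃ₐ[ℚ] FieldL, f iL = iL ∧ f zL = zL ^ 2 := by
  obtain ⟨f, h1, h2⟩ := exists_aut 9 (by norm_num)
  refine ⟨f, ?_, ?_⟩
  · rw [h1, show iL ^ 9 = iL * (iL ^ 2) ^ 4 by ring, iL_sq]; ring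
  · rw [h2, show zL ^ 9 = zL ^ 2 * zL ^ 7 by ring, zL_pow]; ring

/-- The automorphism `σ` of `L'` with `i ↦ -i` and `ζ₇ ↦ ζ₇`
(it is determined by these two values). -/
def sigma : FieldL ≃ₐ[ℚ] FieldL := exists_sigma.choose

/-- The automorphism `τ` of `L'` with `i ↦ i` and `ζ₇ ↦ ζ₇²`
(it is determined by these two values). -/
def tau : FieldL ≃ₐ[ℚ] FieldL := exists_tau.choose

theorem sigma_spec : sigma iL = -iL ∧ sigma zL = zL := exists_sigma.choose_spec

theorem tau_spec : tau iL = iL ∧ tau zL = zL ^ 2 := exists_tau.choose_spec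

/-! ### The code -/

/-- The matrix obtained from `X = [[c, -√11 σ(d)], [√11 d, σ(c)]]` by applying an automorphism
`f` of `L'` to its entries, where `f` is extended to `L'(√11)` by `√11 ↦ √11`.
For `f = id` this is `X` itself. -/
def block (f : FieldL ≃ₐ[ℚ] FieldL) (c d : FieldL) : Matrix (Fin 2) (Fin 2) ℂ :=
  !![(f c : ℂ), -(Real.sqrt 11 : ℂ) * (f (sigma d) : ℂ);
     (Real.sqrt 11 : ℂ) * (f d : ℂ), (f (sigma c) : ℂ)]

/-- The matrix `X = [[c, -√11 σ(d)], [√11 d, σ(c)]]`. -/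
def matX (c d : FieldL) : Matrix (Fin 2) (Fin 2) ℂ := block (AlgEquiv.refl) c d

/-- The `6 × 6` matrix `α_τ(X) = diag(X, τ(X), τ²(X))`; an index `(a, k)` stands for
row or column `a` of the `k`-th block. -/
def alphaTau (c d : FieldL) : Matrix (Fin 2 × Fin 3) (Fin 2 × Fin 3) ℂ :=
  Matrix.blockDiagonal fun k : Fin 3 => block (tau ^ (k : ℕ)) c d

/-- The code: all `α_τ(X)` with `c, d ∈ ℤ[i, ζ₇]`. -/
def code : Set (Matrix (Fin 2 × Fin 3) (Fin 2 × Fin 3) ℂ) :=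
  {Z | ∃ c ∈ intRing, ∃ d ∈ intRing, Z = alphaTau c d}

end

/-! ### General notions for space-time codes -/

section General

noncomputable section

variable {m T ι : Type} [Fintype m] [Fintype T] [Fintype ι]

/-- The Frobenius norm. -/
def frob {n : Type} [Fintype n] (A : Matrix n T ℂ) : ℝ :=
  Real.sqrt (∑ i, ∑ j, ‖A i j‖ ^ 2)

/-- Generator matrices of a code `C`: they are independent over `ℝ`, and the codewords are
precisely their integral combinations. -/
def IsGenerating (C : Set (Matrix m T ℂ)) (B : ι → Matrix m T ℂ) : Prop :=
  LinearIndependent ℝ B ∧ C = {X | ∃ g : ι → ℤ, X = ∑ i, g i • B i}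

/-- The code `C` is a lattice of rank `k`. -/
def HasRank (C : Set (Matrix m T ℂ)) (k : ℕ) : Prop :=
  ∃ B : Fin k → Matrix m T ℂ, IsGenerating C B

/-- The nonvanishing determinant property
(the determinant of `X† X` is always a nonnegative real number). -/
def HasNVD [DecidableEq T] (C : Set (Matrix m T ℂ)) : Prop :=
  ∃ κ : ℝ, 0 < κ ∧ ∀ X ∈ C, X ≠ 0 → κ < ((X.conjTranspose * X).det).re

/-- `Γ₁, …, Γ_g, Γ^C` is a partition of the indices, with nonempty `Γ_i`, that makes the code
generated by `B` conditionally `g`-group decodable. -/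
structure IsCondGroupDecodable (B : ι → Matrix m T ℂ) {g : ℕ}
    (Γ : Fin g → Finset ι) (ΓC : Finset ι) : Prop where
  nonempty : ∀ i, (Γ i).Nonempty
  disjoint : ∀ i j, i ≠ j → Disjoint (Γ i) (Γ j)
  disjoint_cond : ∀ i, Disjoint (Γ i) ΓC
  cover : ∀ l, l ∈ ΓC ∨ ∃ i, l ∈ Γ i
  orthogonal : ∀ i j, i ≠ j → ∀ l ∈ Γ i, ∀ k ∈ Γ j,
    frob ((B l).conjTranspose * B k + (B k).conjTranspose * B l) = 0

/-- The exponent `|Γ^C| + max_i |Γ_i|` of `|S|` in the complexity of conditional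
group decoding. -/
def condDegree {g : ℕ} (Γ : Fin g → Finset ι) (ΓC : Finset ι) : ℕ :=
  ΓC.card + Finset.univ.sup fun i => (Γ i).card

/-- A search procedure on a set `V` of candidate vectors: in each step it computes the values of
the metric at two vectors and branches on their comparison; finally it outputs a vector. -/
inductive Search (V : Type) : Type
  | output (v : V) : Search V
  | compare (u v : V) (ifLe ifGt : Search V) : Search V

open Classical in
/-- The output of the procedure for the metric `μ`. -/
def Search.run {V : Type} (μ : V → ℝ) : Search V → V
  | .output v => v
  | .compare u v s t => if μ u ≤ μ v then s.run μ else t.run μ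

open Classical in
/-- The set of vectors at which the procedure computes the metric `μ` when run on `μ`. -/
def Search.evaluated {V : Type} (μ : V → ℝ) : Search V → Finset V
  | .output _ => ∅
  | .compare u v s t => {u, v} ∪ if μ u ≤ μ v then s.evaluated μ else t.evaluated μ

/-- The maximum-likelihood metric `‖Y - H X‖_F²` of the codeword `X = ∑ g_i B_i`. -/
def mlMetric {n : ℕ} (B : ι → Matrix m T ℂ) (S : Finset ℤ) (H : Matrix (Fin n) m ℂ)
    (Y : Matrix (Fin n) T ℂ) (g : ι → S) : ℝ :=
  frob (Y - H * ∑ i, (g i : ℤ) • B i) ^ 2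

/-- Decoding complexity of order `|S|^d`: there is a constant `K` such that for every finite
alphabet `S` there is a search procedure over `S^ι` which, for every number of receive antennas,
every channel matrix `H` and every received matrix `Y`, outputs a maximum-likelihood solution
after computing the metric at no more than `K |S|^d` vectors. -/
def DecodableInOrder (B : ι → Matrix m T ℂ) (d : ℕ) : Prop :=
  ∃ K : ℕ, ∀ S : Finset ℤ, S.Nonempty → ∃ s : Search (ι → S),
    ∀ (n : ℕ) (H : Matrix (Fin n) m ℂ) (Y : Matrix (Fin n) T ℂ),
      (∀ g, mlMetric B S H Y (s.run (mlMetric B S H Y)) ≤ mlMetric B S H Y g) ∧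
      (s.evaluated (mlMetric B S H Y)).card ≤ K * S.card ^ d

/-- A ring in which `0 ≠ 1` and every nonzero element is invertible. -/
def IsDivision (A : Type) [Ring A] : Prop :=
  Nontrivial A ∧ ∀ x : A, x ≠ 0 → IsUnit x

end

end General

end RelayCode

/-!
Two arithmetic facts drive the proof. Since `11` has order `3` modulo `7` and `11³ ≡ 3 (mod 4)`,
`-1` is not a square modulo any prime of `ℚ(ζ₇)` above `11`; by infinite descent at `11` the form
`x² + y² + 11 (z² + w²)` is anisotropic over `ℚ(ζ₇)`, and it is the norm form of both quaternion
algebras. A codeword determinant is the product of the `τ`-conjugates of such a norm, so it is a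
nonzero algebraic integer fixed by `σ` and `τ`; it therefore lies in `ℚ(√-7)`, where the squared
absolute value is the field norm, a positive integer.

For the decoding, each group consists of the multiples of one quaternion unit by the basis of the
real subring `ℤ[ζ₇ + ζ₇⁻¹]`. The units are pairwise orthogonal in the sense of Hurwitz and Radon,
and left multiplication by `H` preserves this, so once the remaining coordinates are fixed the
metric is a sum of functions of the individual groups, which can be minimized one after the other.
-/

namespace RelayCode

section Decoding

namespace Search

variable {V : Type} (μ : V → ℝ)

/-- Sequential composition: run `s`, and continue with the procedure that `k` assigns to its
output. It serves to assemble procedures from smaller ones. -/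
def bind : Search V → (V → Search V) → Search V
  | .output v, k => k v
  | .compare u v s t, k => .compare u v (s.bind k) (t.bind k)

theorem run_bind (s : Search V) (k : V → Search V) :
    (s.bind k).run μ = (k (s.run μ)).run μ := by
  induction s with
  | output v => rfl
  | compare u v s t hs ht => simp only [bind, run]; split_ifs <;> assumption

open Classical in
theorem evaluated_bind (s : Search V) (k : V → Search V) :
    (s.bind k).evaluated μ = s.evaluated μ ∪ (k (s.run μ)).evaluated μ := by
  induction s with
  | output v => simp only [bind, run, evaluated, Finset.empty_union]
  | compare u v s t hs ht =>
    simp only [bind, run, evaluated, Finset.union_assoc]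
    split_ifs <;> simp only [hs, ht]

/-- A best vector among `b` and the outputs of the procedures in a list, found by running these
one after the other and comparing each output with the best vector so far. -/
def bestOf : V → List (Search V) → Search V
  | b, [] => .output b
  | b, s :: l => s.bind fun w => .compare w b (bestOf w l) (bestOf b l)

theorem run_bestOf_cons (b : V) (s : Search V) (l : List (Search V)) :
    (bestOf b (s :: l)).run μ
      = (bestOf (if μ (s.run μ) ≤ μ b then s.run μ else b) l).run μ := by
  simp only [bestOf, run_bind, run]
  split_ifs <;> rfl

theorem run_bestOf_le_init (b : V) (l : List (Search V)) : μ ((bestOf b l).run μ) ≤ μ b := by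
  induction l generalizing b with
  | nil => rfl
  | cons s l ih =>
    rw [run_bestOf_cons]
    refine (ih _).trans ?_
    split_ifs with h
    exacts [h, le_rfl]

theorem run_bestOf_le (b : V) {s : Search V} {l : List (Search V)} (hs : s ∈ l) :
    μ ((bestOf b l).run μ) ≤ μ (s.run μ) := by
  induction l generalizing b with
  | nil => simp at hs
  | cons t l ih =>
    rw [run_bestOf_cons]
    obtain rfl | hs := List.mem_cons.1 hs
    · refine (run_bestOf_le_init μ _ l).trans ?_
      split_ifs with h
      exacts [le_rfl, (not_le.1 h).le]
    · exact ih _ hs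

theorem run_bestOf_mem (b : V) (l : List (Search V)) :
    (bestOf b l).run μ = b ∨ ∃ s ∈ l, (bestOf b l).run μ = s.run μ := by
  induction l generalizing b with
  | nil => exact Or.inl rfl
  | cons s l ih =>
    rw [run_bestOf_cons]
    obtain h | ⟨t, ht, h⟩ := ih (if μ (s.run μ) ≤ μ b then s.run μ else b)
    · split_ifs at h ⊢
      exacts [Or.inr ⟨s, List.mem_cons_self, h⟩, Or.inl h]
    · exact Or.inr ⟨t, List.mem_cons_of_mem s ht, h⟩

theorem card_evaluated_bestOf_le (b : V) {N : ℕ} {l : List (Search V)}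
    (hN : ∀ s ∈ l, (s.evaluated μ).card ≤ N) :
    ((bestOf b l).evaluated μ).card ≤ l.length * (N + 2) := by
  classical
  induction l generalizing b with
  | nil => simp [bestOf, evaluated]
  | cons s l ih =>
    have hl := fun c => ih c fun t ht => hN t (List.mem_cons_of_mem s ht)
    have hs := hN s List.mem_cons_self
    calc ((bestOf b (s :: l)).evaluated μ).card
      _ ≤ (s.evaluated μ).card + (({s.run μ, b} : Finset V).card + l.length * (N + 2)) := by
        rw [bestOf, evaluated_bind, evaluated]
        refine (Finset.card_union_le _ _).trans ?_
        gcongr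
        refine (Finset.card_union_le _ _).trans ?_
        gcongr
        split_ifs
        exacts [hl _, hl _]
      _ ≤ N + (2 + l.length * (N + 2)) := by gcongr; exact Finset.card_le_two
      _ = (s :: l).length * (N + 2) := by rw [List.length_cons]; ring

end Search

variable {ι α : Type} [DecidableEq ι]

open Function (updateFinset)

/-- The vector `v` cannot be improved by changing its coordinates in `J`. -/
def IsMinAlong (μ : (ι → α) → ℝ) (J : Set ι) (v : ι → α) : Prop :=
  ∀ w : ι → α, (∀ j ∉ J, w j = v j) → μ v ≤ μ w

/-- Once the coordinates in `C` are fixed, the effect on `μ` of a change of the coordinates in `G`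
does not depend on the remaining coordinates: this is what makes it possible to minimize over `G`
separately. -/
def Separates (μ : (ι → α) → ℝ) (C G : Finset ι) : Prop :=
  ∀ g h : ι → α, (∀ j ∈ C, g j = h j) → ∀ x y : G → α,
    μ (updateFinset g G x) - μ (updateFinset g G y)
      = μ (updateFinset h G x) - μ (updateFinset h G y)

theorem IsMinAlong.union {μ : (ι → α) → ℝ} {C G : Finset ι} {J : Set ι} {v w : ι → α}
    (hv : IsMinAlong μ J v) (hw : IsMinAlong μ G w) (hwv : ∀ j ∉ G, w j = v j)
    (hsep : Separates μ C G) (hJC : ∀ j ∈ J, j ∉ C) (hGC : Disjoint G C) :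
    IsMinAlong μ (J ∪ G) w := by
  intro h hh
  replace hh : ∀ j ∉ J, j ∉ G → h j = w j := fun j hJ hG => hh j (by simp [hJ, hG])
  have h_v : μ v ≤ μ (updateFinset h G fun j => v j) := hv _ fun j hj => by
    by_cases hG : j ∈ G
    · simp [updateFinset, hG]
    · simp [updateFinset, hG, hh j hj hG, hwv j hG]
  have h_w : μ w ≤ μ (updateFinset w G fun j => h j) := hw _ fun j hj => by
    simp [updateFinset, Finset.mem_coe.not.1 hj]
  have hsame := hsep h w
    (fun j hj => hh j (fun hJ => hJC j hJ hj) (Finset.disjoint_right.1 hGC hj))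
    (fun j => h j) (fun j => v j)
  have h_h : updateFinset h G (fun j => h j) = h := Function.updateFinset_restrict h
  have hv_w : updateFinset w G (fun j => v j) = v := funext fun j => by
    by_cases hG : j ∈ G
    · simp [updateFinset, hG]
    · simp [updateFinset, hG, hwv j hG]
  rw [h_h, hv_w] at hsame
  linarith

variable [Fintype α]

/-- All vectors that agree with `v` outside `G`. -/
noncomputable def variations (G : Finset ι) (v : ι → α) : List (ι → α) :=
  (Finset.univ : Finset (G → α)).toList.map (updateFinset v G)

theorem length_variations (G : Finset ι) (v : ι → α) :
    (variations G v).length = Fintype.card α ^ G.card := by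
  simp [variations]

theorem mem_variations {G : Finset ι} {v w : ι → α} :
    w ∈ variations G v ↔ ∀ j ∉ G, w j = v j := by
  simp only [variations, List.mem_map, Finset.mem_toList, Finset.mem_univ, true_and]
  constructor
  · rintro ⟨x, rfl⟩ j hj
    simp [updateFinset, hj]
  · refine fun h => ⟨fun j => w j, funext fun j => ?_⟩
    by_cases hj : j ∈ G
    · simp [updateFinset, hj]
    · simp [updateFinset, hj, h j hj]

namespace Search

/-- Exhaustive search over the coordinates in `G`. -/
noncomputable def minimizeOn (G : Finset ι) (v : ι → α) : Search (ι → α) :=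
  bestOf v ((variations G v).map output)

theorem run_minimizeOn (μ : (ι → α) → ℝ) (G : Finset ι) (v : ι → α) :
    ∀ j ∉ G, (minimizeOn G v).run μ j = v j := by
  rcases run_bestOf_mem μ v ((variations G v).map output) with h | ⟨s, hs, h⟩
  · exact fun j _ => congrFun h j
  · obtain ⟨w, hw, rfl⟩ := List.mem_map.1 hs
    rw [minimizeOn, h]
    exact mem_variations.1 hw

theorem isMinAlong_run_minimizeOn (μ : (ι → α) → ℝ) (G : Finset ι) (v : ι → α) :
    IsMinAlong μ G ((minimizeOn G v).run μ) := fun _ hw =>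
  run_bestOf_le μ v <| List.mem_map_of_mem <| mem_variations.2 fun j hj =>
    (hw j hj).trans (run_minimizeOn μ G v j hj)

theorem card_evaluated_minimizeOn_le (μ : (ι → α) → ℝ) (G : Finset ι) (v : ι → α) :
    ((minimizeOn G v).evaluated μ).card ≤ 2 * Fintype.card α ^ G.card := by
  have h : ∀ s ∈ (variations G v).map output, (s.evaluated μ).card ≤ 0 := by
    simp [evaluated]
  simpa [minimizeOn, length_variations, mul_comm] using card_evaluated_bestOf_le μ v h

/-- Exhaustive search over one group of coordinates after the other. -/
noncomputable def descend : List (Finset ι) → (ι → α) → Search (ι → α)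
  | [], v => .output v
  | G :: Gs, v => (descend Gs v).bind (minimizeOn G)

theorem run_descend (μ : (ι → α) → ℝ) (Gs : List (Finset ι)) (v : ι → α) {j : ι}
    (hj : ∀ G ∈ Gs, j ∉ G) : (descend Gs v).run μ j = v j := by
  induction Gs with
  | nil => rfl
  | cons G Gs ih =>
    rw [List.forall_mem_cons] at hj
    rw [descend, run_bind, run_minimizeOn μ G _ j hj.1, ih hj.2]

theorem isMinAlong_run_descend {μ : (ι → α) → ℝ} {C : Finset ι} {Gs : List (Finset ι)}
    (hsep : ∀ G ∈ Gs, Separates μ C G) (hC : ∀ G ∈ Gs, Disjoint G C) (v : ι → α) :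
    IsMinAlong μ {j | ∃ G ∈ Gs, j ∈ G} ((descend Gs v).run μ) := by
  induction Gs with
  | nil => exact fun _ hw => (congrArg μ (funext fun j => hw j (by simp))).ge
  | cons G Gs ih =>
    rw [List.forall_mem_cons] at hsep hC
    have hunion : {j | ∃ G' ∈ G :: Gs, j ∈ G'} = {j | ∃ G' ∈ Gs, j ∈ G'} ∪ (G : Set ι) := by
      ext j
      simp [or_comm]
    rw [hunion, descend, run_bind]
    exact (ih hsep.2 hC.2).union (isMinAlong_run_minimizeOn μ G _) (run_minimizeOn μ G _) hsep.1
      (fun j ⟨G', hG', hj⟩ => Finset.disjoint_left.1 (hC.2 G' hG') hj) hC.1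

theorem card_evaluated_descend_le (μ : (ι → α) → ℝ) {Gs : List (Finset ι)} {N : ℕ}
    (hN : ∀ G ∈ Gs, Fintype.card α ^ G.card ≤ N) (v : ι → α) :
    ((descend Gs v).evaluated μ).card ≤ 2 * Gs.length * N := by
  classical
  induction Gs with
  | nil => simp [descend, evaluated]
  | cons G Gs ih =>
    rw [List.forall_mem_cons] at hN
    rw [descend, evaluated_bind]
    calc _ ≤ _ := Finset.card_union_le _ _
      _ ≤ 2 * Gs.length * N + 2 * N := by
        gcongr
        · exact ih hN.2
        · exact (card_evaluated_minimizeOn_le μ G _).trans (by gcongr; exact hN.1)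
      _ = 2 * (G :: Gs).length * N := by rw [List.length_cons]; ring

/-- Conditional group search: for every choice of the coordinates in `C`, minimize over one group
of coordinates after the other, and keep the best of the resulting vectors. -/
noncomputable def sweep (C : Finset ι) (Gs : List (Finset ι)) (v : ι → α) : Search (ι → α) :=
  bestOf v ((variations C v).map (descend Gs))

theorem run_sweep_le {μ : (ι → α) → ℝ} {C : Finset ι} {Gs : List (Finset ι)}
    (hsep : ∀ G ∈ Gs, Separates μ C G) (hC : ∀ G ∈ Gs, Disjoint G C)
    (hcov : ∀ j, j ∈ C ∨ ∃ G ∈ Gs, j ∈ G) (v g : ι → α) :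
    μ ((sweep C Gs v).run μ) ≤ μ g := by
  have hmem : updateFinset v C (fun j => g j) ∈ variations C v :=
    mem_variations.2 fun j hj => by simp [updateFinset, hj]
  refine (run_bestOf_le μ v (List.mem_map_of_mem hmem)).trans
    (isMinAlong_run_descend hsep hC _ g fun j hj => ?_)
  rw [run_descend μ Gs _ fun G hG hjG => hj ⟨G, hG, hjG⟩]
  simp [updateFinset, (hcov j).resolve_right hj]

theorem card_evaluated_sweep_le (μ : (ι → α) → ℝ) {C : Finset ι} {Gs : List (Finset ι)} {N : ℕ}
    (hN : ∀ G ∈ Gs, Fintype.card α ^ G.card ≤ N) (v : ι → α) :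
    ((sweep C Gs v).evaluated μ).card
      ≤ Fintype.card α ^ C.card * (2 * Gs.length * N + 2) := by
  have h : ∀ s ∈ (variations C v).map (descend Gs),
      (s.evaluated μ).card ≤ 2 * Gs.length * N := by
    rintro _ hs
    obtain ⟨w, -, rfl⟩ := List.mem_map.1 hs
    exact card_evaluated_descend_le μ hN w
  simpa [sweep, length_variations] using card_evaluated_bestOf_le μ v h

end Search

end Decoding

section Metric

open scoped Matrix
open Function (updateFinset)

variable {m T ι : Type} [Fintype m] [Fintype T] [Fintype ι]

/-- The matrices `B` that are mutually orthogonal to `A` in the sense of Hurwitz and Radon. Then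
the real trace inner product of `H A` and `H B` vanishes for every channel matrix `H`. -/
def hurwitzRadon {k : Type} (A : Matrix k T ℂ) : AddSubgroup (Matrix k T ℂ) :=
  (AddMonoidHom.mk' (fun B => A * Bᴴ + B * Aᴴ) fun B B' => by
    rw [Matrix.conjTranspose_add, Matrix.mul_add, Matrix.add_mul]; abel).ker

theorem mem_hurwitzRadon {k : Type} {A B : Matrix k T ℂ} :
    B ∈ hurwitzRadon A ↔ A * Bᴴ + B * Aᴴ = 0 := AddMonoidHom.mem_ker

theorem mem_hurwitzRadon_comm {k : Type} {A B : Matrix k T ℂ} :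
    B ∈ hurwitzRadon A ↔ A ∈ hurwitzRadon B := by
  simp only [mem_hurwitzRadon, add_comm]

theorem mul_mem_hurwitzRadon {k : Type} (H : Matrix k m ℂ) {A B : Matrix m T ℂ}
    (h : B ∈ hurwitzRadon A) : H * B ∈ hurwitzRadon (H * A) := by
  rw [mem_hurwitzRadon] at h ⊢
  calc H * A * (H * B)ᴴ + H * B * (H * A)ᴴ = H * (A * Bᴴ + B * Aᴴ) * Hᴴ := by
        simp only [Matrix.conjTranspose_mul, Matrix.mul_add, Matrix.add_mul, Matrix.mul_assoc]
    _ = 0 := by rw [h, Matrix.mul_zero, Matrix.zero_mul]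

theorem frob_sq {k : Type} [Fintype k] (A : Matrix k T ℂ) :
    frob A ^ 2 = (A * Aᴴ).trace.re := by
  rw [frob, Real.sq_sqrt (by positivity)]
  simp only [Matrix.trace, Matrix.diag, Matrix.mul_apply, Matrix.conjTranspose_apply,
    Complex.re_sum]
  refine Finset.sum_congr rfl fun i _ => Finset.sum_congr rfl fun j _ => ?_
  rw [← Complex.normSq_eq_norm_sq, ← starRingEnd_apply, Complex.mul_conj, Complex.ofReal_re]

theorem frob_zero {k : Type} [Fintype k] : frob (0 : Matrix k T ℂ) = 0 := by
  simp [frob]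

theorem frob_sq_sub_sub {k : Type} [Fintype k] (P : Matrix k T ℂ) {U V : Matrix k T ℂ}
    (h : V ∈ hurwitzRadon U) :
    frob (P - U - V) ^ 2 = frob (P - U) ^ 2 + frob (P - V) ^ 2 - frob P ^ 2 := by
  have hexpand : (P - U - V) * (P - U - V)ᴴ
      = (P - U) * (P - U)ᴴ + (P - V) * (P - V)ᴴ - P * Pᴴ + (U * Vᴴ + V * Uᴴ) := by
    simp only [Matrix.conjTranspose_sub, Matrix.sub_mul, Matrix.mul_sub]
    abel
  rw [mem_hurwitzRadon.1 h, add_zero] at hexpand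
  simp only [frob_sq, hexpand, Matrix.trace_sub, Matrix.trace_add, Complex.sub_re, Complex.add_re]

section mlMetric

variable [DecidableEq ι]

theorem sum_updateFinset_zsmul {M : Type*} [AddCommGroup M] (B : ι → M) (S : Finset ℤ)
    {C G : Finset ι} (hGC : Disjoint G C) (g : ι → S) (x : G → S) :
    ∑ i, (updateFinset g G x i : ℤ) • B i
      = ∑ i ∈ C, (g i : ℤ) • B i + ∑ i : G, (x i : ℤ) • B i
        + ∑ i ∈ (C ∪ G)ᶜ, (g i : ℤ) • B i := by
  have hout : ∀ D : Finset ι, Disjoint D G →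
      ∑ i ∈ D, (updateFinset g G x i : ℤ) • B i = ∑ i ∈ D, (g i : ℤ) • B i := fun D hD =>
    Finset.sum_congr rfl fun i hi => by
      rw [updateFinset, dif_neg (Finset.disjoint_left.1 hD hi)]
  have hin : ∑ i ∈ G, (updateFinset g G x i : ℤ) • B i = ∑ i : G, (x i : ℤ) • B i := by
    rw [← Finset.sum_coe_sort]
    exact Finset.sum_congr rfl fun i _ => by rw [updateFinset, dif_pos i.2]
  rw [← Finset.sum_add_sum_compl (C ∪ G), Finset.sum_union hGC.symm, hin, hout C hGC.symm,
    hout (C ∪ G)ᶜ (Finset.disjoint_left.2 fun i hi hiG => by simp [hiG] at hi)]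

variable {B : ι → Matrix m T ℂ} (S : Finset ℤ) {n : ℕ} (H : Matrix (Fin n) m ℂ)
  (Y : Matrix (Fin n) T ℂ) {C G : Finset ι} (hGC : Disjoint G C)
  (horth : ∀ l ∈ G, ∀ k ∉ C ∪ G, B k ∈ hurwitzRadon (B l))

include hGC horth

theorem mlMetric_updateFinset (g : ι → S) (x : G → S) :
    mlMetric B S H Y (updateFinset g G x)
      = frob (Y - H * ∑ i ∈ C, (g i : ℤ) • B i - H * ∑ i : G, (x i : ℤ) • B i) ^ 2
        + frob (Y - H * ∑ i ∈ C, (g i : ℤ) • B i - H * ∑ i ∈ (C ∪ G)ᶜ, (g i : ℤ) • B i) ^ 2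
        - frob (Y - H * ∑ i ∈ C, (g i : ℤ) • B i) ^ 2 := by
  rw [← frob_sq_sub_sub, mlMetric, sum_updateFinset_zsmul B S hGC, Matrix.mul_add, Matrix.mul_add,
    ← sub_sub, ← sub_sub]
  refine mul_mem_hurwitzRadon H (sum_mem fun k hk => zsmul_mem ?_ _)
  exact mem_hurwitzRadon_comm.1 <| sum_mem fun l _ => zsmul_mem
    (mem_hurwitzRadon_comm.1 <| horth l l.2 k (Finset.mem_compl.1 hk)) _

theorem separates_mlMetric : Separates (mlMetric B S H Y) C G := by
  intro g h hgh x y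
  have hC : ∑ i ∈ C, (g i : ℤ) • B i = ∑ i ∈ C, (h i : ℤ) • B i :=
    Finset.sum_congr rfl fun i hi => by rw [hgh i hi]
  simp only [mlMetric_updateFinset S H Y hGC horth, hC]
  ring

end mlMetric

theorem decodableInOrder_of_hurwitzRadon {B : ι → Matrix m T ℂ} {g : ℕ}
    {Γ : Fin g → Finset ι} {ΓC : Finset ι} (hΓ : IsCondGroupDecodable B Γ ΓC)
    (horth : ∀ i j, i ≠ j → ∀ l ∈ Γ i, ∀ k ∈ Γ j, B k ∈ hurwitzRadon (B l)) :
    DecodableInOrder B (condDegree Γ ΓC) := by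
  classical
  refine ⟨2 * g + 2, fun S ⟨a, ha⟩ => ⟨Search.sweep ΓC (List.ofFn Γ) fun _ => ⟨a, ha⟩,
    fun n H Y => ⟨Search.run_sweep_le ?_ ?_ ?_ _, ?_⟩⟩⟩
  · refine List.forall_mem_ofFn_iff.2 fun i =>
      separates_mlMetric S H Y (hΓ.disjoint_cond i) fun l hl k hk => ?_
    rw [Finset.mem_union, not_or] at hk
    obtain ⟨j, hj⟩ := (hΓ.cover k).resolve_left hk.1
    exact horth i j (by rintro rfl; exact hk.2 hj) l hl k hj
  · exact List.forall_mem_ofFn_iff.2 hΓ.disjoint_cond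
  · simpa using hΓ.cover
  · have hS : 0 < S.card := Finset.card_pos.2 ⟨a, ha⟩
    set e := Finset.univ.sup fun i => (Γ i).card
    have hN : ∀ G ∈ List.ofFn Γ, Fintype.card S ^ G.card ≤ S.card ^ e := by
      refine List.forall_mem_ofFn_iff.2 fun i => ?_
      rw [Fintype.card_coe]
      exact Nat.pow_le_pow_right hS
        (Finset.le_sup (f := fun i => (Γ i).card) (Finset.mem_univ i))
    calc _ ≤ S.card ^ ΓC.card * (2 * g * S.card ^ e + 2) := by
          simpa using Search.card_evaluated_sweep_le (mlMetric B S H Y) hN _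
      _ ≤ S.card ^ ΓC.card * (2 * g * S.card ^ e + 2 * S.card ^ e) := by
          gcongr
          exact Nat.le_mul_of_pos_right 2 (pow_pos hS e)
      _ = (2 * g + 2) * S.card ^ condDegree Γ ΓC := by
          rw [condDegree, pow_add]
          ring

end Metric

section Anisotropy

theorem eq_zero_of_sq_add_sq_eq_zero {R : Type*} [CommRing R] (h2 : IsUnit (2 : R)) {n : ℕ}
    (hn : Odd n) (hpow : ∀ r : R, r ^ (2 * n + 1) = r) {x y : R} (h : x ^ 2 + y ^ 2 = 0) :
    x = 0 := by
  have hxx : x ^ 2 = -y ^ 2 := eq_neg_of_add_eq_zero_left h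
  have hxy : x * y = 0 := by
    refine h2.mul_left_cancel ?_
    have hneg : x * y = -(x * y) := calc
      x * y = x ^ (2 * n + 1) * y := by rw [hpow]
      _ = (x ^ 2) ^ n * x * y := by rw [pow_succ, pow_mul]
      _ = -(x * y ^ (2 * n + 1)) := by rw [hxx, hn.neg_pow, ← pow_mul, pow_succ]; ring
      _ = -(x * y) := by rw [hpow]
    linear_combination hneg
  obtain ⟨j, rfl⟩ := hn
  calc x = x ^ (2 * (2 * j + 1) + 1) := (hpow x).symm
    _ = x ^ 2 * x * x ^ (4 * j) := by ring
    _ = 0 := by rw [hxx]; linear_combination -y * x ^ (4 * j) * hxy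

theorem pow_eq_self_of_adjoin_eq_top {R : Type*} [CommRing R] (p : ℕ) [Fact p.Prime] [CharP R p]
    (k : ℕ) {s : Set R} (hs : Algebra.adjoin ℤ s = ⊤) (hpow : ∀ x ∈ s, x ^ p ^ k = x) (x : R) :
    x ^ p ^ k = x :=
  DFunLike.congr_fun (AlgHom.ext_of_adjoin_eq_top hs hpow :
    (iterateFrobenius R p k).toIntAlgHom = AlgHom.id ℤ R) x

theorem dvd_of_dvd_sq_add_sq {R : Type*} [CommRing R] {n p k : ℕ} [IsCyclotomicExtension {n} ℤ R]
    [Fact p.Prime] (hp : ¬ IsUnit (p : R)) (h1 : p ^ k ≡ 1 [MOD n]) (h3 : p ^ k % 4 = 3)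
    {x y : R} (h : (p : R) ∣ x ^ 2 + y ^ 2) : (p : R) ∣ x := by
  let I : Ideal R := Ideal.span {(p : R)}
  have : CharP (R ⧸ I) p := CharP.quotient R p hp
  -- The Frobenius power `r ↦ r ^ p ^ k` fixes the roots of unity, which generate the quotient.
  have hpow : ∀ r : R ⧸ I, r ^ p ^ k = r := by
    have hgen := ((IsCyclotomicExtension.iff_adjoin_eq_top {n} ℤ R).1 inferInstance).2
    refine pow_eq_self_of_adjoin_eq_top p k
      (s := Ideal.Quotient.mk I '' {b | ∃ a ∈ ({n} : Set ℕ), a ≠ 0 ∧ b ^ a = 1}) ?_ ?_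
    · have := (AlgHom.map_adjoin (Ideal.Quotient.mkₐ ℤ I) _).symm.trans (congrArg _ hgen)
      rwa [Algebra.map_top,
        (AlgHom.range_eq_top _).2 (Ideal.Quotient.mkₐ_surjective ℤ I)] at this
    · rintro _ ⟨b, ⟨a, rfl, -, hb⟩, rfl⟩
      rw [← map_pow]
      exact congrArg _ (by rw [pow_eq_pow_of_modEq h1 hb, pow_one])
  obtain ⟨j, hj⟩ : ∃ j, p ^ k = 2 * (2 * j + 1) + 1 := ⟨p ^ k / 4, by omega⟩
  have h2 : IsUnit (2 : R ⧸ I) := by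
    refine IsUnit.of_mul_eq_one (2 * j + 2 : R ⧸ I) ?_
    have hk : k ≠ 0 := by rintro rfl; simp at h3
    have := congrArg (Nat.cast : ℕ → R ⧸ I) hj
    rw [Nat.cast_pow, CharP.cast_eq_zero, zero_pow hk] at this
    push_cast at this
    linear_combination -this
  simp only [hj] at hpow
  rw [← Ideal.Quotient.eq_zero_iff_dvd] at h ⊢
  exact eq_zero_of_sq_add_sq_eq_zero h2 ⟨j, rfl⟩ hpow (by simpa using h)

section Descent

variable {R : Type*} [CommRing R] [IsDomain R] {π : R} (hπ0 : π ≠ 0)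
  (hπ : ∀ x y : R, π ∣ x ^ 2 + y ^ 2 → π ∣ x)

include hπ0 hπ

theorem exists_mul_of_form_eq_zero {x y z w : R} (h : x ^ 2 + y ^ 2 + π * (z ^ 2 + w ^ 2) = 0) :
    ∃ x' y', x = π * x' ∧ y = π * y' ∧ z ^ 2 + w ^ 2 + π * (x' ^ 2 + y' ^ 2) = 0 := by
  have hdvd : π ∣ x ^ 2 + y ^ 2 := ⟨-(z ^ 2 + w ^ 2), by linear_combination h⟩
  obtain ⟨x', rfl⟩ := hπ x y hdvd
  obtain ⟨y', rfl⟩ := hπ y _ (add_comm (_ ^ 2) (y ^ 2) ▸ hdvd)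
  exact ⟨x', y', rfl, rfl, mul_left_cancel₀ hπ0 (by linear_combination h)⟩

theorem pow_dvd_of_form_eq_zero (n : ℕ) {x y z w : R}
    (h : x ^ 2 + y ^ 2 + π * (z ^ 2 + w ^ 2) = 0) : π ^ n ∣ x := by
  induction n generalizing x y z w with
  | zero => simp
  | succ n ih =>
    obtain ⟨x', y', rfl, rfl, h'⟩ := exists_mul_of_form_eq_zero hπ0 hπ h
    obtain ⟨z', w', rfl, rfl, h''⟩ := exists_mul_of_form_eq_zero hπ0 hπ h'
    rw [pow_succ']
    exact mul_dvd_mul_left π (ih h'')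

theorem eq_zero_of_form_eq_zero [WfDvdMonoid R] (hunit : ¬ IsUnit π) {x y z w : R}
    (h : x ^ 2 + y ^ 2 + π * (z ^ 2 + w ^ 2) = 0) : x = 0 ∧ y = 0 ∧ z = 0 ∧ w = 0 := by
  have hfst : ∀ {x y z w : R}, x ^ 2 + y ^ 2 + π * (z ^ 2 + w ^ 2) = 0 → x = 0 := by
    intro x y z w h
    by_contra hx
    obtain ⟨n, hn⟩ := FiniteMultiplicity.of_not_isUnit hunit hx
    exact hn (pow_dvd_of_form_eq_zero hπ0 hπ (n + 1) h)
  obtain rfl : x = 0 := hfst h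
  obtain rfl : y = 0 := hfst (y := 0) (z := z) (w := w) (by linear_combination h)
  have hzw : z ^ 2 + w ^ 2 + π * (0 ^ 2 + 0 ^ 2) = 0 :=
    mul_left_cancel₀ hπ0 (by linear_combination h)
  exact ⟨rfl, rfl, hfst hzw, hfst (y := z) (z := 0) (w := 0) (by linear_combination hzw)⟩

end Descent

open NumberField in
theorem eq_zero_of_form_eq_zero_of_cyclotomic {K : Type*} [Field K] [CharZero K] {n p k : ℕ}
    [NeZero n] [IsCyclotomicExtension {n} ℚ K] [Fact p.Prime] (h1 : p ^ k ≡ 1 [MOD n])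
    (h3 : p ^ k % 4 = 3) {x y z w : K} (h : x ^ 2 + y ^ 2 + p * (z ^ 2 + w ^ 2) = 0) :
    x = 0 ∧ y = 0 ∧ z = 0 ∧ w = 0 := by
  have := IsCyclotomicExtension.numberField {n} ℚ K
  have hunit : ¬ IsUnit (p : 𝓞 K) := fun hp => by
    rw [← map_natCast (algebraMap ℤ (𝓞 K)) p] at hp
    exact (Nat.prime_iff_prime_int.1 Fact.out).not_isUnit (isUnit_of_map_unit _ _ hp)
  have hp0 : (p : 𝓞 K) ≠ 0 := Nat.cast_ne_zero.2 (Fact.out : p.Prime).ne_zero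
  obtain ⟨b, hb⟩ :=
    IsLocalization.exist_integer_multiples_of_finite (nonZeroDivisors (𝓞 K)) ![x, y, z, w]
  have hb0 : algebraMap (𝓞 K) K b ≠ 0 :=
    IsFractionRing.to_map_ne_zero_of_mem_nonZeroDivisors b.2
  choose a ha using hb
  simp only [Algebra.smul_def] at ha
  have hR : a 0 ^ 2 + a 1 ^ 2 + p * (a 2 ^ 2 + a 3 ^ 2) = 0 := by
    apply FaithfulSMul.algebraMap_injective (𝓞 K) K
    simp only [map_add, map_mul, map_pow, map_natCast, map_zero, ha]
    simp only [Matrix.cons_val]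
    linear_combination (algebraMap (𝓞 K) K b) ^ 2 * h
  obtain ⟨h0, h1, h2, h3⟩ := eq_zero_of_form_eq_zero hp0
    (fun _ _ => dvd_of_dvd_sq_add_sq hunit h1 h3) hunit hR
  have hv : ∀ i, a i = 0 → ![x, y, z, w] i = 0 := fun i hi => by
    simpa [hi, hb0] using (ha i).symm
  exact ⟨hv 0 h0, hv 1 h1, hv 2 h2, hv 3 h3⟩

end Anisotropy

theorem isAlgebraic_zeta7 : IsAlgebraic ℚ zeta7 :=
  (zeta7_primitive.isIntegral (by norm_num)).tower_top.isAlgebraic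

instance fieldK_cyclotomic : IsCyclotomicExtension {7} ℚ FieldK := by
  change IsCyclotomicExtension {7} ℚ FieldK.toSubalgebra
  rw [IntermediateField.adjoin_simple_toSubalgebra_of_isAlgebraic isAlgebraic_zeta7]
  exact zeta7_primitive.adjoin_isCyclotomicExtension ℚ

theorem eq_zero_of_form_eq_zero_fieldK {x y z w : FieldK}
    (h : x ^ 2 + y ^ 2 + 11 * (z ^ 2 + w ^ 2) = 0) : x = 0 ∧ y = 0 ∧ z = 0 ∧ w = 0 := by
  have : Fact (Nat.Prime 11) := ⟨by norm_num⟩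
  exact eq_zero_of_form_eq_zero_of_cyclotomic (n := 7) (p := 11) (k := 3) (by decide) (by norm_num)
    (by exact_mod_cast h)

section Quaternion

open Quaternion

theorem isDivision_of_anisotropic {F : Type} [Field F] {a b c : F}
    (h : ∀ q : ℍ[F,a,b,c], (star q * q).re = 0 → q = 0) : IsDivision ℍ[F,a,b,c] := by
  refine ⟨inferInstance, fun q hq => ?_⟩
  have hN : (star q * q).re ≠ 0 := fun h0 => hq (h q h0)
  have hunit : IsUnit (star q * q) := by
    rw [QuaternionAlgebra.star_mul_eq_coe]
    exact (IsUnit.mk0 _ hN).map (algebraMap F ℍ[F,a,b,c])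
  exact ((star_comm_self (x := q)).isUnit_mul_iff.1 hunit).2

theorem re_star_mul_self {F : Type*} [CommRing F] {a b : F} (q : ℍ[F,a,0,b]) :
    (star q * q).re = q.re ^ 2 - a * q.imI ^ 2 - b * q.imJ ^ 2 + a * b * q.imK ^ 2 := by
  simp only [QuaternionAlgebra.re_mul, QuaternionAlgebra.re_star, QuaternionAlgebra.imI_star,
    QuaternionAlgebra.imJ_star, QuaternionAlgebra.imK_star]
  ring

theorem isDivision_neg_eleven_neg_one : IsDivision (QuaternionAlgebra FieldK (-11) 0 (-1)) := by
  refine isDivision_of_anisotropic fun q hq => ?_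
  obtain ⟨h1, h2, h3, h4⟩ :=
    eq_zero_of_form_eq_zero_fieldK (x := q.re) (y := q.imJ) (z := q.imI) (w := q.imK)
      (by linear_combination (re_star_mul_self q).symm.trans hq)
  ext1 <;> assumption

theorem isDivision_neg_one_neg_eleven : IsDivision (QuaternionAlgebra FieldK (-1) 0 (-11)) := by
  refine isDivision_of_anisotropic fun q hq => ?_
  obtain ⟨h1, h2, h3, h4⟩ :=
    eq_zero_of_form_eq_zero_fieldK (x := q.re) (y := q.imI) (z := q.imJ) (w := q.imK)
      (by linear_combination (re_star_mul_self q).symm.trans hq)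
  ext1 <;> assumption

end Quaternion

section Fields

open Polynomial

theorem exists_add_mul_of_mem_adjoin_insert {R A : Type*} [CommRing R] [CommRing A] [Algebra R A]
    {s : Set A} {w x : A} (hw : w ^ 2 ∈ Algebra.adjoin R s)
    (hx : x ∈ Algebra.adjoin R (insert w s)) :
    ∃ a ∈ Algebra.adjoin R s, ∃ b ∈ Algebra.adjoin R s, x = a + w * b := by
  induction hx using Algebra.adjoin_induction with
  | mem x hx =>
    rcases hx with rfl | hx
    · exact ⟨0, zero_mem _, 1, one_mem _, by simp⟩
    · exact ⟨x, Algebra.subset_adjoin hx, 0, zero_mem _, by simp⟩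
  | algebraMap r => exact ⟨_, algebraMap_mem _ r, 0, zero_mem _, by simp⟩
  | add x y _ _ hx hy =>
    obtain ⟨a, ha, b, hb, rfl⟩ := hx
    obtain ⟨a', ha', b', hb', rfl⟩ := hy
    exact ⟨a + a', add_mem ha ha', b + b', add_mem hb hb', by ring⟩
  | mul x y _ _ hx hy =>
    obtain ⟨a, ha, b, hb, rfl⟩ := hx
    obtain ⟨a', ha', b', hb', rfl⟩ := hy
    exact ⟨a * a' + w ^ 2 * (b * b'), add_mem (mul_mem ha ha') (mul_mem hw (mul_mem hb hb')),
      a * b' + b * a', add_mem (mul_mem ha hb') (mul_mem hb ha'), by ring⟩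

theorem coe_iL : (iL : ℂ) = Complex.I := rfl

theorem coe_zL : (zL : ℂ) = zeta7 := rfl

/-- The inclusion of `ℚ(ζ₇)` in `ℚ(i, ζ₇)`. -/
noncomputable def incl : FieldK →ₐ[ℚ] FieldL :=
  IntermediateField.inclusion (IntermediateField.adjoin.mono ℚ _ _ (by simp))

theorem exists_aeval_eq_incl (a : FieldK) : ∃ p : ℚ[X], aeval zL p = incl a := by
  have h : (a : ℂ) ∈ FieldK.toSubalgebra := a.2
  rw [IntermediateField.adjoin_simple_toSubalgebra_of_isAlgebraic isAlgebraic_zeta7,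
    Algebra.adjoin_singleton_eq_range_aeval] at h
  obtain ⟨p, hp⟩ := h
  exact ⟨p, Subtype.ext ((aeval_algHom_apply FieldL.val zL p).symm.trans hp)⟩

theorem exists_eq_incl_add_iL_mul_incl (c : FieldL) :
    ∃ a b : FieldK, c = incl a + iL * incl b := by
  have hI : IsAlgebraic ℚ Complex.I := Complex.isIntegral_rat_I.isAlgebraic
  have hc : (c : ℂ) ∈ FieldL.toSubalgebra := c.2
  rw [IntermediateField.adjoin_toSubalgebra_of_isAlgebraic
    (by rintro x (rfl | rfl) <;> [exact hI; exact isAlgebraic_zeta7])] at hc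
  obtain ⟨a, ha, b, hb, hab⟩ :=
    exists_add_mul_of_mem_adjoin_insert (by rw [Complex.I_sq]; exact neg_mem (one_mem _)) hc
  exact ⟨⟨a, IntermediateField.algebra_adjoin_le_adjoin ℚ _ ha⟩,
    ⟨b, IntermediateField.algebra_adjoin_le_adjoin ℚ _ hb⟩, Subtype.ext hab⟩

theorem fieldL_aut_ext {f g : FieldL ≃ₐ[ℚ] FieldL} (hi : f iL = g iL) (hz : f zL = g zL) :
    f = g := by
  refine AlgEquiv.coe_toAlgHom_injective (IntermediateField.algHom_ext_of_eq_adjoin ℚ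
    (S := FieldL) rfl ?_)
  rintro x (rfl | rfl)
  exacts [hi, hz]

theorem sigma_mul_sigma : sigma * sigma = 1 :=
  fieldL_aut_ext (by simp [sigma_spec.1]) (by simp [sigma_spec.2])

theorem commute_sigma_tau : Commute sigma tau :=
  fieldL_aut_ext (by simp [sigma_spec.1, tau_spec.1]) (by simp [sigma_spec.2, tau_spec.2])

theorem tau_pow_iL (k : ℕ) : (tau ^ k) iL = iL := by
  induction k with
  | zero => rfl
  | succ k ih => rw [pow_succ, AlgEquiv.mul_apply, tau_spec.1, ih]

theorem tau_pow_zL (k : ℕ) : (tau ^ k) zL = zL ^ 2 ^ k := by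
  induction k with
  | zero => simp
  | succ k ih => rw [pow_succ, AlgEquiv.mul_apply, tau_spec.2, map_pow, ih, ← pow_mul, pow_succ]

theorem tau_pow_three : tau ^ 3 = 1 :=
  fieldL_aut_ext (tau_pow_iL 3) (by
    rw [tau_pow_zL, AlgEquiv.one_apply]
    linear_combination zL * zL_pow)

theorem sigma_incl (a : FieldK) : sigma (incl a) = incl a := by
  obtain ⟨p, hp⟩ := exists_aeval_eq_incl a
  rw [← hp, ← aeval_algHom_apply sigma, sigma_spec.2]

theorem exists_eq_incl_of_sigma_eq {x : FieldL} (hx : sigma x = x) : ∃ a, x = incl a := by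
  obtain ⟨a, b, rfl⟩ := exists_eq_incl_add_iL_mul_incl x
  refine ⟨a, ?_⟩
  simp only [map_add, map_mul, sigma_incl, sigma_spec.1] at hx
  linear_combination -hx / 2

theorem add_sq_add_pow_four_mem_fieldQ7 {x : ℂ} (hx : x ^ 7 = 1) : x + x ^ 2 + x ^ 4 ∈ FieldQ7 := by
  rcases eq_or_ne x 1 with rfl | h1
  · norm_num
  have hsum : 1 + x + x ^ 2 + x ^ 3 + x ^ 4 + x ^ 5 + x ^ 6 = 0 :=
    mul_left_cancel₀ (sub_ne_zero.2 h1) (by linear_combination hx)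
  have h7 : (Real.sqrt 7 : ℂ) ^ 2 = 7 := by norm_cast; simp
  have hsq : (2 * (x + x ^ 2 + x ^ 4) + 1) ^ 2 = ((Real.sqrt 7 : ℂ) * Complex.I) ^ 2 := by
    rw [mul_pow, Complex.I_sq, h7]
    linear_combination 8 * hsum + 4 * x * hx
  have hmem : 2 * (x + x ^ 2 + x ^ 4) + 1 ∈ FieldQ7 := by
    have hs : (Real.sqrt 7 : ℂ) * Complex.I ∈ FieldQ7 :=
      IntermediateField.mem_adjoin_simple_self ℚ _
    rcases sq_eq_sq_iff_eq_or_eq_neg.1 hsq with h | h <;> rw [h]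
    exacts [hs, neg_mem hs]
  convert div_mem (sub_mem hmem (one_mem FieldQ7)) (ofNat_mem FieldQ7 2) using 1
  ring

theorem trace_tau_mem_fieldQ7 (a : FieldK) :
    ((∑ k : Fin 3, (tau ^ (k : ℕ)) (incl a) : FieldL) : ℂ) ∈ FieldQ7 := by
  obtain ⟨p, hp⟩ := exists_aeval_eq_incl a
  have hmon (n : ℕ) : ((∑ k : Fin 3, (tau ^ (k : ℕ)) (zL ^ n) : FieldL) : ℂ) ∈ FieldQ7 := by
    convert add_sq_add_pow_four_mem_fieldQ7 (x := zeta7 ^ n)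
      (by rw [pow_right_comm, zeta7_primitive.pow_eq_one, one_pow]) using 1
    simp only [map_pow, tau_pow_zL, Fin.sum_univ_three]
    push_cast [coe_zL]
    simp only [Fin.val_zero, Fin.val_one, Fin.val_two]
    ring
  rw [← hp, aeval_def, eval₂_eq_sum_range]
  simp only [map_sum, map_mul, AlgEquiv.commutes]
  rw [Finset.sum_comm]
  simp only [← Finset.mul_sum]
  push_cast
  exact sum_mem fun n _ => mul_mem (algebraMap_mem FieldQ7 _) (by exact_mod_cast hmon n)

theorem mem_fieldQ7_of_fixed {x : FieldL} (hσ : sigma x = x) (hτ : tau x = x) :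
    (x : ℂ) ∈ FieldQ7 := by
  obtain ⟨a, rfl⟩ := exists_eq_incl_of_sigma_eq hσ
  have h := trace_tau_mem_fieldQ7 a
  have hpow : ∀ k : ℕ, (tau ^ k) (incl a) = incl a := fun k => by
    induction k with
    | zero => rfl
    | succ k ih => rw [pow_succ, AlgEquiv.mul_apply, hτ, ih]
  simp only [hpow, Finset.sum_const, Finset.card_univ, Fintype.card_fin] at h
  convert div_mem h (ofNat_mem FieldQ7 3) using 1
  push_cast
  ring

end Fields

section Embedding

theorem sqrt_eleven_mul_self : (Real.sqrt 11 : ℂ) * (Real.sqrt 11 : ℂ) = 11 := by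
  norm_cast
  simp

/-- The images `1, ρ(i), ρ(j), -ρ(k)` of the quaternion units under the embedding
`(-1, -11) → M₂(ℂ)`; the sign makes `X(c, d)` with `c = y₀ + i y₁` and `d = y₂ + i y₃` equal to
`∑ yₜ • unitMat t`. -/
noncomputable def unitMat : Fin 4 → Matrix (Fin 2) (Fin 2) ℂ :=
  ![1, !![Complex.I, 0; 0, -Complex.I], !![0, -(Real.sqrt 11 : ℂ); (Real.sqrt 11 : ℂ), 0],
    !![0, (Real.sqrt 11 : ℂ) * Complex.I; (Real.sqrt 11 : ℂ) * Complex.I, 0]]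

theorem block_eq_sum_unitMat {f : FieldL ≃ₐ[ℚ] FieldL} (hf : f iL = iL) {y : Fin 4 → FieldL}
    (hy : ∀ t, sigma (y t) = y t) :
    block f (y 0 + iL * y 1) (y 2 + iL * y 3) = ∑ t, (f (y t) : ℂ) • unitMat t := by
  ext a b
  fin_cases a <;> fin_cases b <;>
    simp [block, unitMat, Fin.sum_univ_four, hf, hy, sigma_spec.1, coe_iL] <;>
    ring

/-- The matrices `unitMat t` satisfy the defining relations of `(-1, -11)` over `ℚ(ζ₇)`. -/
noncomputable def quatBasis :
    QuaternionAlgebra.Basis (Matrix (Fin 2) (Fin 2) ℂ) (-1 : FieldK) 0 (-11) where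
  i := unitMat 1
  j := unitMat 2
  k := -unitMat 3
  i_mul_i := by
    simp [unitMat, Matrix.one_fin_two]
  j_mul_j := by
    have hsmul (M : Matrix (Fin 2) (Fin 2) ℂ) : (-11 : FieldK) • M = (-11 : ℂ) • M := rfl
    simp [unitMat, hsmul, Matrix.one_fin_two, sqrt_eleven_mul_self, -neg_smul]
  i_mul_j := by
    simp [unitMat, mul_comm]
  j_mul_i := by
    simp [unitMat, mul_comm]

theorem quatBasis_lift (q : QuaternionAlgebra FieldK (-1) 0 (-11)) :
    quatBasis.lift q = matX (incl q.re + iL * incl q.imI) (incl q.imJ + iL * incl (-q.imK)) := by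
  have hsmul (r : FieldK) (M : Matrix (Fin 2) (Fin 2) ℂ) : r • M = (incl r : ℂ) • M := rfl
  have h := block_eq_sum_unitMat (f := AlgEquiv.refl) rfl
    (y := ![incl q.re, incl q.imI, incl q.imJ, incl (-q.imK)])
    (by simp [Fin.forall_fin_succ, sigma_incl])
  simp only [Matrix.cons_val] at h
  rw [matX, h, QuaternionAlgebra.Basis.lift, Algebra.algebraMap_eq_smul_one]
  simp [Fin.sum_univ_four, quatBasis, unitMat, hsmul]

theorem exists_quaternion_embedding :
    ∃ ρ : QuaternionAlgebra FieldK (-1) 0 (-11) →ₐ[FieldK] Matrix (Fin 2) (Fin 2) ℂ,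
      Function.Injective ρ ∧ Set.range ρ = {X | ∃ c d : FieldL, X = matX c d} := by
  refine ⟨quatBasis.liftHom, (injective_iff_map_eq_zero _).2 fun x hx => ?_, ?_⟩
  · by_contra h0
    exact not_isUnit_zero (hx ▸ (isDivision_neg_one_neg_eleven.2 x h0).map quatBasis.liftHom)
  · ext M
    constructor
    · rintro ⟨q, rfl⟩
      exact ⟨_, _, quatBasis_lift q⟩
    · rintro ⟨c, d, rfl⟩
      obtain ⟨p, q, rfl⟩ := exists_eq_incl_add_iL_mul_incl c
      obtain ⟨r, s, rfl⟩ := exists_eq_incl_add_iL_mul_incl d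
      exact ⟨⟨p, q, r, -s⟩, (quatBasis_lift _).trans (by simp)⟩

end Embedding

section Determinant

/-- The reduced norm `c σ(c) + 11 d σ(d)`, which is the determinant of `X(c, d)`. -/
noncomputable def redNorm (c d : FieldL) : FieldL := c * sigma c + 11 * (d * sigma d)

theorem det_block (f : FieldL ≃ₐ[ℚ] FieldL) (c d : FieldL) :
    (block f c d).det = (f (redNorm c d) : ℂ) := by
  have h11 : ((11 : FieldL) : ℂ) = 11 := rfl
  rw [block, Matrix.det_fin_two_of, redNorm]
  simp only [map_add, map_mul, map_ofNat]
  push_cast [h11]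
  linear_combination (f d : ℂ) * f (sigma d) * sqrt_eleven_mul_self

theorem det_alphaTau (c d : FieldL) :
    (alphaTau c d).det = ((∏ k : Fin 3, (tau ^ (k : ℕ)) (redNorm c d) : FieldL) : ℂ) := by
  rw [alphaTau, Matrix.det_blockDiagonal]
  push_cast
  simp_rw [det_block]

theorem sigma_redNorm (c d : FieldL) : sigma (redNorm c d) = redNorm c d := by
  have hσ (x : FieldL) : sigma (sigma x) = x := DFunLike.congr_fun sigma_mul_sigma x
  simp only [redNorm, map_add, map_mul, map_ofNat, hσ]
  ring

theorem det_alphaTau_mem_fieldQ7 (c d : FieldL) : (alphaTau c d).det ∈ FieldQ7 := by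
  rw [det_alphaTau]
  refine mem_fieldQ7_of_fixed ?_ ?_
  · rw [map_prod]
    refine Finset.prod_congr rfl fun k _ => ?_
    rw [← AlgEquiv.mul_apply, (commute_sigma_tau.pow_right k).eq, AlgEquiv.mul_apply,
      sigma_redNorm]
  · have hτ (x : FieldL) : tau (tau (tau x)) = x := DFunLike.congr_fun tau_pow_three x
    simp only [Fin.prod_univ_three, map_mul, Fin.val_zero, Fin.val_one, Fin.val_two, pow_zero,
      pow_one, pow_two, AlgEquiv.mul_apply, AlgEquiv.one_apply, hτ]
    ring

theorem det_mem_fieldQ7 {Z : Matrix (Fin 2 × Fin 3) (Fin 2 × Fin 3) ℂ} (hZ : Z ∈ code) :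
    Z.det ∈ FieldQ7 := by
  obtain ⟨c, -, d, -, rfl⟩ := hZ
  exact det_alphaTau_mem_fieldQ7 c d

theorem eq_zero_of_redNorm_eq_zero {c d : FieldL} (h : redNorm c d = 0) : c = 0 ∧ d = 0 := by
  obtain ⟨x, y, rfl⟩ := exists_eq_incl_add_iL_mul_incl c
  obtain ⟨z, w, rfl⟩ := exists_eq_incl_add_iL_mul_incl d
  have hK : x ^ 2 + y ^ 2 + 11 * (z ^ 2 + w ^ 2) = 0 := by
    apply incl.injective
    simp only [redNorm, map_add, map_mul, sigma_incl, sigma_spec.1] at h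
    simp only [map_add, map_mul, map_pow, map_ofNat, map_zero]
    linear_combination h + (incl y ^ 2 + 11 * incl w ^ 2) * iL_sq
  obtain ⟨rfl, rfl, rfl, rfl⟩ := eq_zero_of_form_eq_zero_fieldK hK
  simp

theorem alphaTau_zero : alphaTau 0 0 = 0 := by
  have hblock (f : FieldL ≃ₐ[ℚ] FieldL) : block f 0 0 = 0 := by
    simp [block, ← Matrix.ext_iff, Fin.forall_fin_two]
  rw [alphaTau, ← Matrix.blockDiagonal_zero]
  exact congrArg _ (funext fun k => hblock _)

theorem det_ne_zero_of_mem_code {Z : Matrix (Fin 2 × Fin 3) (Fin 2 × Fin 3) ℂ} (hZ : Z ∈ code)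
    (hZ0 : Z ≠ 0) : Z.det ≠ 0 := by
  obtain ⟨c, -, d, -, rfl⟩ := hZ
  rw [det_alphaTau, ne_eq, ZeroMemClass.coe_eq_zero, Finset.prod_eq_zero_iff]
  rintro ⟨k, -, hk⟩
  obtain ⟨rfl, rfl⟩ := eq_zero_of_redNorm_eq_zero ((map_eq_zero_iff _ (AlgEquiv.injective _)).1 hk)
  exact hZ0 alphaTau_zero

theorem isIntegral_of_mem_intRing {x : FieldL} (hx : x ∈ intRing) : IsIntegral ℤ x := by
  refine (Algebra.adjoin_le ?_ : intRing ≤ integralClosure ℤ FieldL) hx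
  rintro x (rfl | rfl)
  · exact .of_pow (n := 2) (by norm_num) (iL_sq ▸ isIntegral_one.neg)
  · exact .of_pow (n := 7) (by norm_num) (zL_pow ▸ isIntegral_one)

theorem isIntegral_det_of_mem_code {Z : Matrix (Fin 2 × Fin 3) (Fin 2 × Fin 3) ℂ}
    (hZ : Z ∈ code) : IsIntegral ℤ Z.det := by
  obtain ⟨c, hc, d, hd, rfl⟩ := hZ
  have haut (f : FieldL ≃ₐ[ℚ] FieldL) {x : FieldL} (hx : IsIntegral ℤ x) : IsIntegral ℤ (f x) :=
    hx.map (f.toAlgHom.restrictScalars ℤ)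
  have hc' := isIntegral_of_mem_intRing hc
  have hd' := isIntegral_of_mem_intRing hd
  have hN : IsIntegral ℤ (redNorm c d) :=
    (hc'.mul (haut sigma hc')).add ((isIntegral_natCast 11).mul (hd'.mul (haut sigma hd')))
  have hdet : IsIntegral ℤ (∏ k : Fin 3, (tau ^ (k : ℕ)) (redNorm c d)) :=
    IsIntegral.prod _ fun k _ => haut _ hN
  rw [det_alphaTau]
  exact hdet.map (FieldL.val.restrictScalars ℤ)

theorem exists_normSq_eq_of_mem_fieldQ7 {x : ℂ} (hx : x ∈ FieldQ7) :
    ∃ q : ℚ, Complex.normSq x = q := by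
  have h7 : Real.sqrt 7 * Real.sqrt 7 = 7 := Real.mul_self_sqrt (by norm_num)
  have hsq : ((Real.sqrt 7 : ℂ) * Complex.I) ^ 2 = algebraMap ℚ ℂ (-7) := by
    rw [mul_pow, Complex.I_sq, pow_two, ← Complex.ofReal_mul, h7]
    simp
  have hx' : x ∈ FieldQ7.toSubalgebra := hx
  rw [IntermediateField.adjoin_simple_toSubalgebra_of_isAlgebraic
    (.of_pow two_pos (hsq ▸ isAlgebraic_algebraMap _)), ← insert_empty_eq] at hx'
  obtain ⟨_, ha, _, hb, rfl⟩ := exists_add_mul_of_mem_adjoin_insert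
    (hsq ▸ algebraMap_mem _ _) hx'
  rw [Algebra.adjoin_empty, Algebra.mem_bot] at ha hb
  obtain ⟨a, rfl⟩ := ha
  obtain ⟨b, rfl⟩ := hb
  refine ⟨a ^ 2 + 7 * b ^ 2, ?_⟩
  set x := algebraMap ℚ ℂ a + Real.sqrt 7 * Complex.I * algebraMap ℚ ℂ b with hx
  have hre : x.re = a := by simp [hx]
  have him : x.im = Real.sqrt 7 * b := by simp [hx]
  rw [Complex.normSq_apply, hre, him]
  push_cast
  linear_combination (b : ℝ) ^ 2 * h7

theorem one_le_normSq_of_isIntegral {x : ℂ} (hx : IsIntegral ℤ x) (h0 : x ≠ 0) {q : ℚ}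
    (hq : Complex.normSq x = q) : 1 ≤ Complex.normSq x := by
  have hint : IsIntegral ℤ (algebraMap ℚ ℂ q) := by
    have : algebraMap ℚ ℂ q = starRingEnd ℂ x * x := by
      rw [← Complex.normSq_eq_conj_mul_self, hq]
      simp
    rw [this]
    exact (hx.map (starRingEnd ℂ).toIntAlgHom).mul hx
  obtain ⟨n, rfl⟩ := IsIntegrallyClosed.isIntegral_iff.1
    ((isIntegral_algebraMap_iff (algebraMap ℚ ℂ).injective).1 hint)
  have hpos := Complex.normSq_pos.2 h0
  rw [hq] at hpos ⊢
  simp only [algebraMap_int_eq, eq_intCast, Rat.cast_intCast] at hpos ⊢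
  exact_mod_cast hpos

theorem code_hasNVD : HasNVD code := by
  refine ⟨1 / 2, by norm_num, fun Z hZ hZ0 => ?_⟩
  obtain ⟨q, hq⟩ := exists_normSq_eq_of_mem_fieldQ7 (det_mem_fieldQ7 hZ)
  have h1 := one_le_normSq_of_isIntegral (isIntegral_det_of_mem_code hZ)
    (det_ne_zero_of_mem_code hZ hZ0) hq
  rw [Matrix.det_mul, Matrix.det_conjTranspose, ← starRingEnd_apply,
    ← Complex.normSq_eq_conj_mul_self, Complex.ofReal_re]
  linarith

end Determinant

section Generators

open Polynomial

/-- Polynomials whose values at `ζ₇` form a `ℤ`-basis of `ℤ[ζ₇]`; the first three values form a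
basis of the real subring `ℤ[ζ₇ + ζ₇⁻¹]`. -/
noncomputable def basisPoly : Fin 6 → ℤ[X] := ![1, X ^ 2 + X ^ 5, X ^ 3 + X ^ 4, X, X ^ 2, X ^ 3]

theorem eq_sum_basisPoly {p : ℤ[X]} (hp : p.natDegree < 6) :
    p = ∑ b, ![p.coeff 0, p.coeff 5, p.coeff 4, p.coeff 1, p.coeff 2 - p.coeff 5,
      p.coeff 3 - p.coeff 4] b • basisPoly b := by
  conv_lhs => rw [p.as_sum_range' 6 hp]
  simp only [Finset.sum_range_succ, Finset.sum_range_zero, Fin.sum_univ_six, basisPoly,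
    Matrix.cons_val, smul_eq_C_mul, C_sub, ← C_mul_X_pow_eq_monomial]
  ring

theorem exists_eq_sum_basisPoly {x : FieldL} (hx : x ∈ Algebra.adjoin ℤ {zL}) :
    ∃ n : Fin 6 → ℤ, x = ∑ b, n b • aeval zL (basisPoly b) := by
  rw [Algebra.adjoin_singleton_eq_range_aeval, AlgHom.mem_range] at hx
  obtain ⟨p, rfl⟩ := hx
  have hroot : aeval zL (cyclotomic 7 ℤ) = 0 := by
    have hzL : IsPrimitiveRoot zL 7 :=
      .of_map_of_injective (f := FieldL.val) zeta7_primitive FieldL.val.injective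
    rw [aeval_def, eval₂_eq_eval_map, map_cyclotomic]
    exact hzL.isRoot_cyclotomic (by norm_num)
  have hdeg : (p %ₘ cyclotomic 7 ℤ).natDegree < 6 := by
    have h := natDegree_modByMonic_lt p (cyclotomic.monic 7 ℤ) (fun h1 => by simp [h1] at hroot)
    rwa [natDegree_cyclotomic] at h
  have h := congrArg (aeval zL) (eq_sum_basisPoly hdeg)
  simp only [aeval_modByMonic_eq_self_of_root hroot, map_sum, map_zsmul] at h
  exact ⟨_, h⟩

/-- The conjugate `τᵏ` of the `b`-th basis element. -/
noncomputable def basisConj (k : Fin 3) (b : Fin 6) : ℂ := aeval (zeta7 ^ 2 ^ (k : ℕ)) (basisPoly b)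

theorem coe_tau_pow_basis (k : Fin 3) (b : Fin 6) :
    (((tau ^ (k : ℕ)) (aeval zL (basisPoly b)) : FieldL) : ℂ) = basisConj k b := by
  have h := aeval_algHom_apply
    ((FieldL.val.comp (tau ^ (k : ℕ)).toAlgHom).restrictScalars ℤ) zL (basisPoly b)
  refine h.symm.trans ?_
  change aeval (((tau ^ (k : ℕ)) zL : FieldL) : ℂ) _ = _
  rw [tau_pow_zL]
  rfl

theorem zeta7_pow_pow_seven (m : ℕ) : (zeta7 ^ m) ^ 7 = 1 := by
  rw [pow_right_comm, zeta7_primitive.pow_eq_one, one_pow]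

theorem star_eq_pow_six {x : ℂ} (hx : x ^ 7 = 1) : star x = x ^ 6 := by
  have h : star x * x = 1 := by
    rw [← starRingEnd_apply, ← Complex.normSq_eq_conj_mul_self, Complex.normSq_eq_norm_sq,
      Complex.norm_eq_one_of_pow_eq_one hx (by norm_num)]
    simp
  linear_combination x ^ 6 * h - star x * hx

theorem star_basisConj (k : Fin 3) {b : Fin 6} (hb : (b : ℕ) < 3) :
    star (basisConj k b) = basisConj k b := by
  have hx := zeta7_pow_pow_seven (2 ^ (k : ℕ))
  unfold basisConj
  generalize zeta7 ^ 2 ^ (k : ℕ) = x at hx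
  obtain rfl | rfl | rfl : b = 0 ∨ b = 1 ∨ b = 2 := by omega
  · simp [basisPoly]
  · simp only [basisPoly, Matrix.cons_val, map_add, map_pow, aeval_X, star_add, star_pow,
      star_eq_pow_six hx]
    linear_combination (x ^ 5 + x ^ 23 + x ^ 16 + x ^ 9 + x ^ 2) * hx
  · simp only [basisPoly, Matrix.cons_val, map_add, map_pow, aeval_X, star_add, star_pow,
      star_eq_pow_six hx]
    linear_combination (x ^ 11 + x ^ 4 + x ^ 17 + x ^ 10 + x ^ 3) * hx

theorem eq_zero_of_aeval_zeta7 {q : ℝ[X]} (hdeg : q.natDegree < 6)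
    (h : ∀ k : Fin 3, aeval (zeta7 ^ 2 ^ (k : ℕ)) q = 0) : q = 0 := by
  have hconj {m : ℕ} (hm : aeval (zeta7 ^ m) q = 0) : aeval (zeta7 ^ (m * 6)) q = 0 := by
    rw [pow_mul, ← star_eq_pow_six (zeta7_pow_pow_seven m), ← starRingEnd_apply, aeval_conj, hm,
      map_zero]
  have hmod {m : ℕ} (hm : aeval (zeta7 ^ m) q = 0) : aeval (zeta7 ^ (m % 7)) q = 0 := by
    rwa [← pow_eq_pow_mod m zeta7_primitive.pow_eq_one]
  -- `1, 2, 4` and their negatives are all the nonzero residues modulo `7`.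
  have hroots : ∀ m ∈ Finset.Icc 1 6, aeval (zeta7 ^ m) q = 0 := by
    intro m hm
    fin_cases hm
    exacts [h 0, h 1, hmod (hconj (h 2)), h 2, hmod (hconj (h 1)), hmod (hconj (h 0))]
  have hinj : Set.InjOn (zeta7 ^ ·) (Finset.Icc 1 6 : Finset ℕ) := by
    intro a ha b hb hab
    simp only [Finset.coe_Icc, Set.mem_Icc] at ha hb
    exact zeta7_primitive.pow_inj (by omega) (by omega) hab
  refine (Polynomial.map_eq_zero (algebraMap ℝ ℂ)).1
    (eq_zero_of_natDegree_lt_card_of_eval_eq_zero' _ ((Finset.Icc 1 6).image (zeta7 ^ ·)) ?_ ?_)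
  · simpa only [Finset.forall_mem_image, eval_map_algebraMap] using hroots
  · rw [Finset.card_image_of_injOn hinj, natDegree_map]
    simpa using hdeg

theorem linearIndependent_basisPoly :
    LinearIndependent ℝ fun b => (basisPoly b).map (algebraMap ℤ ℝ) := by
  rw [Fintype.linearIndependent_iff]
  intro r h
  have hcoeff (n : ℕ) := congrArg (coeff · n) h
  simp only [Fin.sum_univ_six, basisPoly, Matrix.cons_val, Polynomial.map_add, Polynomial.map_pow,
    map_X, Polynomial.map_one, coeff_add, coeff_smul, coeff_X, coeff_one, coeff_X_pow, smul_eq_mul,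
    coeff_zero] at hcoeff
  have h0 := hcoeff 0
  have h1 := hcoeff 1
  have h2 := hcoeff 2
  have h3 := hcoeff 3
  have h4 := hcoeff 4
  have h5 := hcoeff 5
  norm_num at h0 h1 h2 h3 h4 h5
  refine fun b => ?_
  fin_cases b <;> simp <;> linarith

theorem natDegree_basisPoly_lt (b : Fin 6) : (basisPoly b).natDegree < 6 := by
  refine Nat.lt_succ_of_le ?_
  fin_cases b <;>
    simp only [basisPoly, Fin.reduceFinMk, Fin.zero_eta, Fin.mk_one, Matrix.cons_val] <;>
    compute_degree!

theorem linearIndependent_basisConj : LinearIndependent ℝ fun b k => basisConj k b := by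
  rw [Fintype.linearIndependent_iff]
  intro r h
  refine Fintype.linearIndependent_iff.1 linearIndependent_basisPoly r
    (eq_zero_of_aeval_zeta7 ?_ fun k => ?_)
  · refine (natDegree_sum_le_of_forall_le (n := 5) _ _ fun b _ => ?_).trans_lt (by norm_num)
    exact (natDegree_smul_le _ _).trans
      (natDegree_map_le.trans (Nat.le_of_lt_succ (natDegree_basisPoly_lt b)))
  · have hk := congrFun h k
    simp only [Finset.sum_apply, Pi.smul_apply, basisConj, Pi.zero_apply] at hk
    simpa only [map_sum, map_smul, aeval_map_algebraMap] using hk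

/-- The generators of the code, indexed by a unit of the quaternion algebra and an element of the
basis of `ℤ[ζ₇]`. -/
noncomputable def genMat (x : Fin 4 × Fin 6) : Matrix (Fin 2 × Fin 3) (Fin 2 × Fin 3) ℂ :=
  Matrix.blockDiagonal fun k => basisConj k x.2 • unitMat x.1

theorem sigma_aeval_zL (p : ℤ[X]) : sigma (aeval zL p) = aeval zL p := by
  rw [← aeval_map_algebraMap ℚ, ← aeval_algHom_apply sigma, sigma_spec.2]

theorem alphaTau_sum_basisPoly (g : Fin 4 × Fin 6 → ℤ) {y : Fin 4 → FieldL}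
    (hy : ∀ t, y t = ∑ b, g (t, b) • aeval zL (basisPoly b)) :
    alphaTau (y 0 + iL * y 1) (y 2 + iL * y 3) = ∑ x, g x • genMat x := by
  have hσ (t : Fin 4) : sigma (y t) = y t := by
    simp only [hy, map_sum, map_zsmul, sigma_aeval_zL]
  have hτ (k : Fin 3) (t : Fin 4) :
      (((tau ^ (k : ℕ)) (y t) : FieldL) : ℂ) = ∑ b, g (t, b) • basisConj k b := by
    rw [hy]
    simp only [map_sum, map_zsmul, ← coe_tau_pow_basis]
    push_cast
    rfl
  have hsum (k : Fin 3) : block (tau ^ (k : ℕ)) (y 0 + iL * y 1) (y 2 + iL * y 3)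
      = ∑ x : Fin 4 × Fin 6, g x • basisConj k x.2 • unitMat x.1 := by
    rw [block_eq_sum_unitMat (tau_pow_iL k) hσ, Fintype.sum_prod_type]
    simp only [hτ, Finset.sum_smul, smul_assoc]
  ext ⟨i, k⟩ ⟨j, l⟩
  simp only [alphaTau, hsum, genMat, Matrix.sum_apply, Matrix.smul_apply,
    Matrix.blockDiagonal_apply]
  split_ifs <;> simp

theorem code_eq : code = {Z | ∃ g : Fin 4 × Fin 6 → ℤ, Z = ∑ x, g x • genMat x} := by
  ext Z
  constructor
  · rintro ⟨c, hc, d, hd, rfl⟩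
    have hi : iL ^ 2 ∈ Algebra.adjoin ℤ {zL} := iL_sq ▸ neg_mem (one_mem _)
    obtain ⟨y₀, h₀, y₁, h₁, rfl⟩ := exists_add_mul_of_mem_adjoin_insert hi hc
    obtain ⟨y₂, h₂, y₃, h₃, rfl⟩ := exists_add_mul_of_mem_adjoin_insert hi hd
    obtain ⟨n₀, e₀⟩ := exists_eq_sum_basisPoly h₀
    obtain ⟨n₁, e₁⟩ := exists_eq_sum_basisPoly h₁
    obtain ⟨n₂, e₂⟩ := exists_eq_sum_basisPoly h₂
    obtain ⟨n₃, e₃⟩ := exists_eq_sum_basisPoly h₃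
    exact ⟨fun x => ![n₀, n₁, n₂, n₃] x.1 x.2, alphaTau_sum_basisPoly (y := ![y₀, y₁, y₂, y₃]) _
      (Fin.forall_fin_succ.2 ⟨e₀, Fin.forall_fin_succ.2 ⟨e₁, Fin.forall_fin_two.2 ⟨e₂, e₃⟩⟩⟩)⟩
  · rintro ⟨g, rfl⟩
    have hi : iL ∈ intRing := Algebra.subset_adjoin (by simp)
    have hz (p : ℤ[X]) : aeval zL p ∈ intRing :=
      Algebra.adjoin_mono (by simp) (aeval_mem_adjoin_singleton ℤ zL)
    have hy (t : Fin 4) : ∑ b, g (t, b) • aeval zL (basisPoly b) ∈ intRing :=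
      sum_mem fun b _ => zsmul_mem (hz _) _
    exact ⟨_, add_mem (hy 0) (mul_mem hi (hy 1)), _, add_mem (hy 2) (mul_mem hi (hy 3)),
      (alphaTau_sum_basisPoly g fun _ => rfl).symm⟩

theorem linearIndependent_unitMat : LinearIndependent ℂ unitMat := by
  have h11 : (Real.sqrt 11 : ℂ) ≠ 0 := fun h0 => by
    have h := sqrt_eleven_mul_self
    norm_num [h0] at h
  rw [Fintype.linearIndependent_iff]
  intro s h
  have hentry (i j) : (∑ t, s t • unitMat t) i j = 0 := by rw [h]; rfl
  have e00 : s 0 + s 1 * Complex.I = 0 := by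
    simpa [Fin.sum_univ_four, unitMat] using hentry 0 0
  have e01 : -(s 2 * (Real.sqrt 11 : ℂ)) + s 3 * ((Real.sqrt 11 : ℂ) * Complex.I) = 0 := by
    simpa [Fin.sum_univ_four, unitMat] using hentry 0 1
  have e10 : s 2 * (Real.sqrt 11 : ℂ) + s 3 * ((Real.sqrt 11 : ℂ) * Complex.I) = 0 := by
    simpa [Fin.sum_univ_four, unitMat] using hentry 1 0
  have e11 : s 0 + -(s 1 * Complex.I) = 0 := by
    simpa [Fin.sum_univ_four, unitMat] using hentry 1 1
  have h0 : s 0 = 0 := by linear_combination (e00 + e11) / 2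
  have h1 : s 1 * Complex.I = 0 := by linear_combination (e00 - e11) / 2
  have h2 : s 2 * (Real.sqrt 11 : ℂ) = 0 := by linear_combination (e10 - e01) / 2
  have h3 : s 3 * ((Real.sqrt 11 : ℂ) * Complex.I) = 0 := by linear_combination (e10 + e01) / 2
  simp only [mul_eq_zero, h11, Complex.I_ne_zero, or_false] at h1 h2 h3
  exact Fin.forall_fin_succ.2 ⟨h0, Fin.forall_fin_succ.2 ⟨h1, Fin.forall_fin_two.2 ⟨h2, h3⟩⟩⟩

theorem linearIndependent_genMat : LinearIndependent ℝ genMat := by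
  rw [Fintype.linearIndependent_iff]
  rintro g hg ⟨t, b⟩
  refine Fintype.linearIndependent_iff.1 linearIndependent_basisConj (fun b => g (t, b))
    (funext fun k => ?_) b
  have hk : ∑ t, (∑ b, g (t, b) • basisConj k b) • unitMat t = 0 := by
    ext i j
    have h := congrFun (congrFun hg (i, k)) (j, k)
    simp only [genMat, Matrix.sum_apply, Matrix.smul_apply, Matrix.blockDiagonal_apply_eq,
      Fintype.sum_prod_type, Matrix.zero_apply] at h
    simpa only [Matrix.sum_apply, Matrix.smul_apply, Finset.sum_smul, smul_assoc,
      Matrix.zero_apply] using h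
  simpa using Fintype.linearIndependent_iff.1 linearIndependent_unitMat _ hk t

end Generators

section Groups

open scoped Matrix

theorem smul_mem_hurwitzRadon {k T : Type} [Fintype T] {A B : Matrix k T ℂ}
    (h : B ∈ hurwitzRadon A) {a b : ℂ} (ha : star a = a) (hb : star b = b) :
    b • B ∈ hurwitzRadon (a • A) := by
  rw [mem_hurwitzRadon] at h ⊢
  simp only [Matrix.conjTranspose_smul, ha, hb, Matrix.smul_mul, Matrix.mul_smul]
  rw [smul_comm b a, ← smul_add, ← smul_add, h, smul_zero, smul_zero]

theorem blockDiagonal_mem_hurwitzRadon {k T o : Type} [Fintype T] [Fintype o] [DecidableEq o]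
    {M N : o → Matrix k T ℂ} (h : ∀ i, N i ∈ hurwitzRadon (M i)) :
    Matrix.blockDiagonal N ∈ hurwitzRadon (Matrix.blockDiagonal M) := by
  simp only [mem_hurwitzRadon] at h ⊢
  rw [Matrix.blockDiagonal_conjTranspose, Matrix.blockDiagonal_conjTranspose,
    ← Matrix.blockDiagonal_mul, ← Matrix.blockDiagonal_mul, ← Matrix.blockDiagonal_add,
    ← Matrix.blockDiagonal_zero]
  exact congrArg _ (funext h)

theorem conjTranspose_unitMat (t : Fin 4) :
    (unitMat t)ᴴ = ![(1 : ℂ), -1, -1, -1] t • unitMat t := by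
  ext i j
  fin_cases t <;> fin_cases i <;> fin_cases j <;> simp [unitMat]

theorem unitMat_mem_hurwitzRadon {s t : Fin 4} (h : s ≠ t) :
    unitMat t ∈ hurwitzRadon (unitMat s) := by
  rw [mem_hurwitzRadon, conjTranspose_unitMat, conjTranspose_unitMat]
  fin_cases s <;> fin_cases t <;> first
    | exact absurd rfl h
    | simp [unitMat, mul_comm, ← Matrix.ext_iff, Fin.forall_fin_two]

theorem conjTranspose_unitMat_mem_hurwitzRadon {s t : Fin 4} (h : s ≠ t) :
    (unitMat t)ᴴ ∈ hurwitzRadon (unitMat s)ᴴ := by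
  have hsign : ∀ t : Fin 4, star (![(1 : ℂ), -1, -1, -1] t) = ![(1 : ℂ), -1, -1, -1] t := by
    simp [Fin.forall_fin_succ]
  rw [conjTranspose_unitMat, conjTranspose_unitMat]
  exact smul_mem_hurwitzRadon (unitMat_mem_hurwitzRadon h) (hsign s) (hsign t)

theorem genMat_mem_hurwitzRadon {x y : Fin 4 × Fin 6} (hx : (x.2 : ℕ) < 3) (hy : (y.2 : ℕ) < 3)
    (h : x.1 ≠ y.1) : genMat y ∈ hurwitzRadon (genMat x) :=
  blockDiagonal_mem_hurwitzRadon fun k =>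
    smul_mem_hurwitzRadon (unitMat_mem_hurwitzRadon h) (star_basisConj k hx) (star_basisConj k hy)

theorem conjTranspose_genMat_mem_hurwitzRadon {x y : Fin 4 × Fin 6} (hx : (x.2 : ℕ) < 3)
    (hy : (y.2 : ℕ) < 3) (h : x.1 ≠ y.1) : (genMat y)ᴴ ∈ hurwitzRadon (genMat x)ᴴ := by
  simp only [genMat, Matrix.blockDiagonal_conjTranspose, Matrix.conjTranspose_smul,
    star_basisConj _ hx, star_basisConj _ hy]
  exact blockDiagonal_mem_hurwitzRadon fun k => smul_mem_hurwitzRadon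
    (conjTranspose_unitMat_mem_hurwitzRadon h) (star_basisConj k hx) (star_basisConj k hy)

theorem IsGenerating.comp_equiv {m T ι κ : Type} [Fintype ι] [Fintype κ]
    {C : Set (Matrix m T ℂ)} {B : ι → Matrix m T ℂ} (h : IsGenerating C B) (e : κ ≃ ι) :
    IsGenerating C (B ∘ e) := by
  refine ⟨h.1.comp e e.injective, ?_⟩
  rw [h.2]
  ext Z
  constructor
  · rintro ⟨g, rfl⟩
    exact ⟨g ∘ e, (e.sum_comp fun i => g i • B i).symm⟩
  · rintro ⟨g, rfl⟩
    refine ⟨g ∘ e.symm, ?_⟩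
    rw [← e.sum_comp]
    simp only [Function.comp_apply, Equiv.symm_apply_apply]

/-- The matrices `genMat`, enumerated as in the paper by a single index. -/
noncomputable def gen : Fin 24 → Matrix (Fin 2 × Fin 3) (Fin 2 × Fin 3) ℂ :=
  genMat ∘ (finProdFinEquiv (m := 4) (n := 6)).symm

theorem gen_isGenerating : IsGenerating code gen :=
  IsGenerating.comp_equiv ⟨linearIndependent_genMat, code_eq⟩ _

/-- The `t`-th decoding group: the generators that combine the `t`-th quaternion unit with an
element of the real subring. -/
def group (t : Fin 4) : Finset (Fin 24) :=
  {l | ((finProdFinEquiv (m := 4) (n := 6)).symm l).1 = t ∧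
    (((finProdFinEquiv (m := 4) (n := 6)).symm l).2 : ℕ) < 3}

/-- The indices of the conditioning symbols, which are fixed before the groups are decoded. -/
def condGroup : Finset (Fin 24) :=
  {l | 3 ≤ (((finProdFinEquiv (m := 4) (n := 6)).symm l).2 : ℕ)}

theorem gen_isCondGroupDecodable : IsCondGroupDecodable gen group condGroup where
  nonempty := by decide
  disjoint := by decide
  disjoint_cond := by decide
  cover := by decide
  orthogonal s t hst l hl k hk := by
    obtain ⟨rfl, hl'⟩ := (Finset.mem_filter.1 hl).2
    obtain ⟨rfl, hk'⟩ := (Finset.mem_filter.1 hk).2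
    have h := mem_hurwitzRadon.1 (conjTranspose_genMat_mem_hurwitzRadon hl' hk' hst)
    simp only [Matrix.conjTranspose_conjTranspose] at h
    exact (congrArg frob h).trans frob_zero

theorem condDegree_group : condDegree group condGroup = 15 := by decide

theorem gen_decodableInOrder : DecodableInOrder gen 15 := by
  rw [← condDegree_group]
  refine decodableInOrder_of_hurwitzRadon gen_isCondGroupDecodable fun s t hst l hl k hk => ?_
  obtain ⟨rfl, hl'⟩ := (Finset.mem_filter.1 hl).2
  obtain ⟨rfl, hk'⟩ := (Finset.mem_filter.1 hk).2
  exact genMat_mem_hurwitzRadon hl' hk' hst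

end Groups

end RelayCode

theorem proposition1 :
    -- the quaternion algebras `(-11, -1)` and `(-1, -11)` over `ℚ(ζ₇)` are division algebras
    RelayCode.IsDivision (QuaternionAlgebra RelayCode.FieldK (-11) 0 (-1)) ∧
    RelayCode.IsDivision (QuaternionAlgebra RelayCode.FieldK (-1) 0 (-11)) ∧
    -- the matrices `X` with `c, d ∈ ℚ(i, ζ₇)` form a faithful copy of the latter
    (∃ ρ : QuaternionAlgebra RelayCode.FieldK (-1) 0 (-11) →ₐ[RelayCode.FieldK]
        Matrix (Fin 2) (Fin 2) ℂ,
      Function.Injective ρ ∧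
      Set.range ρ = {X | ∃ c d : RelayCode.FieldL, X = RelayCode.matX c d}) ∧
    RelayCode.HasRank RelayCode.code 24 ∧
    RelayCode.HasNVD RelayCode.code ∧
    (∀ X ∈ RelayCode.code, X.det ∈ RelayCode.FieldQ7) ∧
    -- conditionally 4-group decodable with decoding complexity of order `|S|^15`
    (∃ (B : Fin 24 → Matrix (Fin 2 × Fin 3) (Fin 2 × Fin 3) ℂ)
        (Γ : Fin 4 → Finset (Fin 24)) (ΓC : Finset (Fin 24)),
      RelayCode.IsGenerating RelayCode.code B ∧
      RelayCode.IsCondGroupDecodable B Γ ΓC ∧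
      RelayCode.condDegree Γ ΓC = 15 ∧
      RelayCode.DecodableInOrder B 15) := by
  exact ⟨RelayCode.isDivision_neg_eleven_neg_one, RelayCode.isDivision_neg_one_neg_eleven,
    RelayCode.exists_quaternion_embedding, ⟨RelayCode.gen, RelayCode.gen_isGenerating⟩,
    RelayCode.code_hasNVD, fun _ => RelayCode.det_mem_fieldQ7,
    RelayCode.gen, RelayCode.group, RelayCode.condGroup, RelayCode.gen_isGenerating,
    RelayCode.gen_isCondGroupDecodable, RelayCode.condDegree_group,
    RelayCode.gen_decodableInOrder⟩
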